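/- **Setting.** Let $G$ be a group acting by automorphisms on an abelian group $(A,+)$, where $G$, $A$ and the action are $\emptyset$-definable in a first-order structure $\mathcal G$. Let $B\subset\mathcal G$ be a finite set of parameters and let $h\colon G\times G\to A$ be a $B$-definable 2-cocycle, i.e. $h(g_1,g_2)+h(g_1g_2,g_3)=h(g_1,g_2g_3)+g_1\cdot h(g_2,g_3)$ and $h(g,e)=h(e,g)=0$, whose image is finite and contained in the definable closure $\mathrm{dcl}(B)$. Let $A_0$ be the subgroup of $A$ generated by the image of $h$; it is invariant under the action of $G$. Let $\mathcal G^*\succ\mathcal G$ be a monster model, that is, an elementary extension which is $\kappa$-saturated and strongly $\kappa$-homogeneous for an uncountable strong limit cardinal $\kappa$ greater than the cardinalities of the language and of $\mathcal G$; "bounded" means of cardinality less than $\kappa$. Let $G^*,A^*,h^*$ be the interpretations of $G,A,h$ in $\mathcal G^*$ (so $h^*$ has the same image as $h$), and let $\widetilde{G^*}$ be the group $A^*\times G^*$ with multiplication $(a_1,g_1)(a_2,g_2)=(a_1+g_1\cdot a_2+h^*(g_1,g_2),\,g_1g_2)$. For $X=G^*$ or $X=\widetilde{G^*}$ let $X^{000}_B$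 (respectively $X^{00}_B$) be the smallest subgroup of $X$ of bounded index that is invariant under $\mathrm{Aut}(\mathcal G^*/B)$ (respectively, type-definable over $B$). Let $A^*_1$ be a subgroup of $A^*$ of bounded index which is type-definable over $B$ and invariant under the action of $G^*$. For a subgroup $C\le A^*$ invariant under $G^*$, and $K\le G^*$, the action and $h^*$ induce an action on $A_0/(C\cap A_0)$ and a 2-cocycle $\overline{h^*}\colon K\times K\to A_0/(C\cap A_0)$. It is *non-split via $B$-invariant functions* if there is no function $f\colon K\to A_0/(C\cap A_0)$ that is invariant under $\mathrm{Aut}(\mathcal G^*/B)$ and satisfies $f(e)=0$ and $\overline{h^*}(g_1,g_2)=f(g_1)+g_1\cdot f(g_2)-f(g_1g_2)$ for all $g_1,g_2\in K$ (for $K$ invariant under $\mathrm{Aut}(\mathcal G^*/B)$). **Theorem.** Assume that 1. the induced 2-cocycle $\overline{h^*}\colon {G^*}^{00}_B\times{G^*}^{00}_B\to A_0/(A^*_1\cap A_0)$ is non-split via $B$-invariant functions, and 2. $A_0/(A^*_1\cap A_0)$ is torsion free. Then $\widetilde{G^*}^{000}_B\neq\widetilde{G^*}^{00}_B$. Suppose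 furthermore that ${G^*}^{000}_B=G^*$ and that, for every proper subgroup $H$ of $A^*$ of bounded index which is type-definable over $B$ and invariant under the action of $G^*$, the induced 2-cocycle $\overline{h^*}\colon G^*\times G^*\to A_0/(H\cap A_0)$ is non-split via $B$-invariant functions. Then $\widetilde{G^*}^{00}_B=\widetilde{G^*}$. -/

import Mathlib

open FirstOrder Cardinal

universe u v w w' uG uA x

noncomputable section

/-! ### Group cohomology: normalised 2-cocycles, extensions, splitting -/

section Cocycles

variable {G : Type uG} {A : Type uA} [Group G] [AddCommGroup A] [DistribMulAction G A]

/-- A (normalised) 2-cocycle, or factor set, on `G` with values in the `G`-module `A`. -/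
structure TwoCocycle (G : Type uG) (A : Type uA) [Group G] [AddCommGroup A]
    [DistribMulAction G A] where
  toFun : G → G → A
  cocycle' : ∀ g₁ g₂ g₃ : G,
    toFun g₁ g₂ + toFun (g₁ * g₂) g₃ = toFun g₁ (g₂ * g₃) + g₁ • toFun g₂ g₃
  map_one_right' : ∀ g : G, toFun g 1 = 0
  map_one_left' : ∀ g : G, toFun 1 g = 0

instance : CoeFun (TwoCocycle G A) (fun _ => G → G → A) := ⟨TwoCocycle.toFun⟩

/-- The image `im(h)` of a 2-cocycle `h`. -/
def TwoCocycle.image (h : TwoCocycle G A) : Set A := {a | ∃ g₁ g₂ : G, h g₁ g₂ = a}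

/-- `h` is split via the function `f`. -/
def TwoCocycle.IsSplitVia (h : TwoCocycle G A) (f : G → A) : Prop :=
  (∀ g₁ g₂ : G, h g₁ g₂ = f g₁ + g₁ • f g₂ - f (g₁ * g₂)) ∧ f 1 = 0

/-- The restriction of a 2-cocycle to a subgroup. -/
def TwoCocycle.restrict (h : TwoCocycle G A) (K : Subgroup G) : TwoCocycle K A where
  toFun g₁ g₂ := h g₁ g₂
  cocycle' g₁ g₂ g₃ := h.cocycle' g₁ g₂ g₃
  map_one_right' g := h.map_one_right' g
  map_one_left' g := h.map_one_left' g

/-- The underlying set `A × G` of the extension of `G` by `A` given by the 2-cocycle `h`. -/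
@[ext]
structure CocycleExt (h : TwoCocycle G A) where
  fst : A
  snd : G

namespace CocycleExt

variable {h : TwoCocycle G A}

instance : Mul (CocycleExt h) :=
  ⟨fun x y => ⟨x.fst + x.snd • y.fst + h x.snd y.snd, x.snd * y.snd⟩⟩

instance : One (CocycleExt h) := ⟨⟨0, 1⟩⟩

instance : Inv (CocycleExt h) :=
  ⟨fun x => ⟨-(x.snd⁻¹ • x.fst) - h x.snd⁻¹ x.snd, x.snd⁻¹⟩⟩

/-- The group `(A × G, *)`, with
`(a₁, g₁) * (a₂, g₂) = (a₁ + g₁ • a₂ + h(g₁, g₂), g₁ g₂)`. -/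
instance : Group (CocycleExt h) :=
  Group.ofLeftAxioms
    (by
      intro x y z
      ext
      · change x.fst + x.snd • y.fst + h x.snd y.snd + (x.snd * y.snd) • z.fst
            + h (x.snd * y.snd) z.snd
          = x.fst + x.snd • (y.fst + y.snd • z.fst + h y.snd z.snd)
            + h x.snd (y.snd * z.snd)
        have := h.cocycle' x.snd y.snd z.snd
        rw [smul_add, smul_add, mul_smul]
        calc _ = x.fst + x.snd • y.fst + x.snd • y.snd • z.fst
              + (h x.snd y.snd + h (x.snd * y.snd) z.snd) := by abel
          _ = _ := by rw [this]; abel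
      · exact mul_assoc _ _ _)
    (by
      intro x
      ext
      · change 0 + (1 : G) • x.fst + h 1 x.snd = x.fst
        rw [h.map_one_left']; simp
      · exact one_mul _)
    (by
      intro x
      ext
      · change -(x.snd⁻¹ • x.fst) - h x.snd⁻¹ x.snd + x.snd⁻¹ • x.fst + h x.snd⁻¹ x.snd = 0
        abel
      · exact inv_mul_cancel _)

theorem mul_def (x y : CocycleExt h) :
    x * y = ⟨x.fst + x.snd • y.fst + h x.snd y.snd, x.snd * y.snd⟩ := rfl

end CocycleExt

/-- `C` is invariant under the action of `G`. -/
def AddSubgroup.InvariantUnder (G : Type uG) {A : Type uA} [Group G] [AddCommGroup A]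
    [DistribMulAction G A] (C : AddSubgroup A) : Prop :=
  ∀ (g : G), ∀ a ∈ C, g • a ∈ C

/-- The subgroup `A₀` of `A` generated by the image of the 2-cocycle `h`. -/
def TwoCocycle.imageSubgroup (h : TwoCocycle G A) : AddSubgroup A :=
  AddSubgroup.closure h.image

theorem TwoCocycle.mem_imageSubgroup (h : TwoCocycle G A) (g₁ g₂ : G) :
    h g₁ g₂ ∈ h.imageSubgroup :=
  AddSubgroup.subset_closure ⟨g₁, g₂, rfl⟩

theorem TwoCocycle.imageSubgroup_invariant (h : TwoCocycle G A) :
    h.imageSubgroup.InvariantUnder G := by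
  intro g a ha
  induction ha using AddSubgroup.closure_induction with
  | mem x hx =>
    obtain ⟨g₂, g₃, rfl⟩ := hx
    have := h.cocycle' g g₂ g₃
    rw [← sub_eq_iff_eq_add'] at this
    rw [← this]
    exact sub_mem (add_mem (h.mem_imageSubgroup _ _) (h.mem_imageSubgroup _ _))
      (h.mem_imageSubgroup _ _)
  | zero => rw [smul_zero]; exact zero_mem _
  | add x y _ _ hx hy => rw [smul_add]; exact add_mem hx hy
  | neg x _ hx => rw [smul_neg]; exact neg_mem hx

/-- The group of coefficients `A₀ / (C ∩ A₀)` of the 2-cocycle induced by `h`, where `C` is a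
`G`-invariant subgroup of `A`. -/
def TwoCocycle.Coeff (h : TwoCocycle G A) (C : AddSubgroup A) (_hC : C.InvariantUnder G) :
    Type uA :=
  h.imageSubgroup ⧸ C.addSubgroupOf h.imageSubgroup

namespace TwoCocycle

variable (h : TwoCocycle G A) (C : AddSubgroup A) (hC : C.InvariantUnder G)

instance : AddCommGroup (h.Coeff C hC) :=
  inferInstanceAs (AddCommGroup (h.imageSubgroup ⧸ C.addSubgroupOf h.imageSubgroup))

/-- The quotient map `A₀ → A₀ / (C ∩ A₀)`. -/
def toCoeff : h.imageSubgroup →+ h.Coeff C hC :=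
  QuotientAddGroup.mk' (C.addSubgroupOf h.imageSubgroup)

theorem toCoeff_surjective : Function.Surjective (h.toCoeff C hC) :=
  QuotientAddGroup.mk'_surjective _

/-- The action of `g : G` on `A₀`. -/
def imageSubgroupSMul (g : G) : h.imageSubgroup →+ h.imageSubgroup :=
  ((DistribSMul.toAddMonoidHom A g).comp h.imageSubgroup.subtype).codRestrict h.imageSubgroup
    (fun a => h.imageSubgroup_invariant g a a.2)

/-- The action of `g : G` on `A₀ / (C ∩ A₀)` induced by its action on `A₀`. -/
def coeffSMul (g : G) : h.Coeff C hC →+ h.Coeff C hC :=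
  QuotientAddGroup.map (C.addSubgroupOf h.imageSubgroup) (C.addSubgroupOf h.imageSubgroup)
    (h.imageSubgroupSMul g) (fun a ha => hC g a ha)

theorem coeffSMul_toCoeff (g : G) (a : h.imageSubgroup) :
    h.coeffSMul C hC g (h.toCoeff C hC a)
      = h.toCoeff C hC ⟨g • (a : A), h.imageSubgroup_invariant g a a.2⟩ := rfl

/-- The action of `G` on `A₀ / (C ∩ A₀)` induced by its action on `A`. -/
instance : DistribMulAction G (h.Coeff C hC) where
  smul g x := h.coeffSMul C hC g x
  one_smul x := by
    obtain ⟨a, rfl⟩ := h.toCoeff_surjective C hC x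
    change h.coeffSMul C hC 1 _ = _
    rw [coeffSMul_toCoeff]
    congr 1
    exact Subtype.ext (one_smul G (a : A))
  mul_smul g k x := by
    obtain ⟨a, rfl⟩ := h.toCoeff_surjective C hC x
    change h.coeffSMul C hC (g * k) _ = h.coeffSMul C hC g (h.coeffSMul C hC k _)
    rw [coeffSMul_toCoeff, coeffSMul_toCoeff, coeffSMul_toCoeff]
    congr 1
    exact Subtype.ext (mul_smul g k (a : A))
  smul_zero g := (h.coeffSMul C hC g).map_zero
  smul_add g := (h.coeffSMul C hC g).map_add

theorem smul_toCoeff (g : G) (a : h.imageSubgroup) :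
    g • h.toCoeff C hC a
      = h.toCoeff C hC ⟨g • (a : A), h.imageSubgroup_invariant g a a.2⟩ := rfl

/-- The induced 2-cocycle `G × G → A₀ / (C ∩ A₀)`. -/
def induced : TwoCocycle G (h.Coeff C hC) where
  toFun g₁ g₂ := h.toCoeff C hC ⟨h g₁ g₂, h.mem_imageSubgroup g₁ g₂⟩
  cocycle' g₁ g₂ g₃ := by
    rw [smul_toCoeff, ← map_add, ← map_add]
    congr 1
    exact Subtype.ext (h.cocycle' g₁ g₂ g₃)
  map_one_right' g := by
    rw [← map_zero (h.toCoeff C hC)]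
    congr 1
    exact Subtype.ext (h.map_one_right' g)
  map_one_left' g := by
    rw [← map_zero (h.toCoeff C hC)]
    congr 1
    exact Subtype.ext (h.map_one_left' g)

end TwoCocycle

end Cocycles

/-! ### Model theory: definable closure, monster models, invariant and type-definable sets -/

section ModelTheory

variable {L : FirstOrder.Language.{u, v}}

/-- The definable closure of `B`: the set of elements `a` such that `{a}` is `B`-definable. -/
def definableClosure (L : FirstOrder.Language.{u, v}) {M : Type w} [L.Structure M] (B : Set M) :
    Set M :=
  {a | B.Definable₁ L {a}}

/-- `κ`-saturation: every set of formulas in finitely many variables, over a set of fewer than `κ`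
parameters, which is finitely satisfiable in `N` is realised in `N`. -/
def IsSaturatedModel (L : FirstOrder.Language.{u, v}) (N : Type w') [L.Structure N]
    (κ : Cardinal.{w'}) : Prop :=
  ∀ (C : Set N), #C < κ → ∀ (k : ℕ) (p : Set (L[[C]].Formula (Fin k))),
    (∀ q ⊆ p, q.Finite → ∃ a : Fin k → N, ∀ φ ∈ q, φ.Realize a) →
      ∃ a : Fin k → N, ∀ φ ∈ p, φ.Realize a

/-- Strong `κ`-homogeneity: every partial elementary map between subsets of `N` of size less than
`κ` extends to an automorphism of `N`. -/
def IsStronglyHomogeneous (L : FirstOrder.Language.{u, v}) (N : Type w') [L.Structure N]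
    (κ : Cardinal.{w'}) : Prop :=
  ∀ (C : Set N), #C < κ → ∀ f : C → N,
    (∀ (k : ℕ) (φ : L.Formula (Fin k)) (a : Fin k → C),
      φ.Realize (fun i => f (a i)) ↔ φ.Realize (fun i => (a i : N))) →
      ∃ σ : N ≃[L] N, ∀ c : C, σ c = f c

/-- `N` is a monster model extending `M` (with respect to `κ`): `κ` is an uncountable strong limit
cardinal larger than the cardinalities of the language and of `M`, and `N` is `κ`-saturated and
strongly `κ`-homogeneous. The embedding of `M` into `N` is kept separately. "Small" and "bounded"
mean: of cardinality less than `κ`. -/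
structure IsMonster (L : FirstOrder.Language.{u, v}) (M : Type w) (N : Type w') [L.Structure N]
    (κ : Cardinal.{w'}) : Prop where
  isStrongLimit : κ.IsStrongLimit
  aleph0_lt : ℵ₀ < κ
  card_language_lt : Cardinal.lift.{w'} L.card < Cardinal.lift.{max u v} κ
  card_model_lt : Cardinal.lift.{w'} #M < Cardinal.lift.{w} κ
  isSaturated : IsSaturatedModel L N κ
  isStronglyHomogeneous : IsStronglyHomogeneous L N κ

variable {N : Type w'} [L.Structure N]

/-- `S ⊆ N^ι` is invariant under `Aut(N/B)`. -/
def IsInvariantOver (L : FirstOrder.Language.{u, v}) {N : Type w'} [L.Structure N] (B : Set N)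
    {ι : Type x} (S : Set (ι → N)) : Prop :=
  ∀ σ : N ≃[L] N, (∀ b ∈ B, σ b = b) → ∀ a ∈ S, (fun i => σ (a i)) ∈ S

/-- `S ⊆ N^ι` is type-definable over `B`: an intersection of `B`-definable sets. -/
def IsTypeDefinableOver (L : FirstOrder.Language.{u, v}) {N : Type w'} [L.Structure N] (B : Set N)
    {ι : Type x} (S : Set (ι → N)) : Prop :=
  ∃ 𝒟 : Set (Set (ι → N)), (∀ D ∈ 𝒟, B.Definable L D) ∧ S = ⋂₀ 𝒟

/-- For a group `X`, sitting in a Cartesian power of `N` through the coordinate map `c`, the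
component `X^{000}_B`: the smallest (i.e. the intersection of all) `B`-invariant subgroup of
bounded index. -/
def component000 (L : FirstOrder.Language.{u, v}) {N : Type w'} [L.Structure N]
    (κ : Cardinal.{w'}) (B : Set N) {X : Type w'} [Group X] {ι : Type x} (c : X → ι → N) : Subgroup X :=
  sInf {H : Subgroup X | IsInvariantOver L B (c '' H) ∧ #(X ⧸ H) < κ}

/-- For a group `X`, sitting in a Cartesian power of `N` through the coordinate map `c`, the
component `X^{00}_B`: the smallest (i.e. the intersection of all) subgroup of bounded index which
is type-definable over `B`. -/
def component00 (L : FirstOrder.Language.{u, v}) {N : Type w'} [L.Structure N]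
    (κ : Cardinal.{w'}) (B : Set N) {X : Type w'} [Group X] {ι : Type x} (c : X → ι → N) : Subgroup X :=
  sInf {H : Subgroup X | IsTypeDefinableOver L B (c '' H) ∧ #(X ⧸ H) < κ}

end ModelTheory

/-! ### Transfer along an elementary embedding -/

/-- The concatenation of three tuples. -/
def tri {K α β γ : Type*} (x : α → K) (y : β → K) (z : γ → K) : α ⊕ β ⊕ γ → K :=
  Sum.elim x (Sum.elim y z)

theorem tri_comp {K K' α β γ : Type*} (f : K → K') (x : α → K) (y : β → K) (z : γ → K) :
    f ∘ tri x y z = tri (f ∘ x) (f ∘ y) (f ∘ z) := by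
  simp [tri, Sum.comp_elim]

section Transfer

variable {L : FirstOrder.Language.{u, v}} {M : Type w} {N : Type w'} [L.Structure M] [L.Structure N]

/-- The properties `P` on `M` and `Q` on `N` are given by the same formula with parameters
in `M`. -/
def SameFormula (j : M ↪ₑ[L] N) {ε : Type} (P : (ε → M) → Prop) (Q : (ε → N) → Prop) : Prop :=
  ∃ φ : L.Formula (M ⊕ ε),
    (∀ v, φ.Realize (Sum.elim id v) ↔ P v) ∧ ∀ v, φ.Realize (Sum.elim j v) ↔ Q v

namespace SameFormula

variable {j : M ↪ₑ[L] N} {ε α β γ : Type}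

theorem imp {P P' : (ε → M) → Prop} {Q Q' : (ε → N) → Prop} (h : SameFormula j P Q)
    (h' : SameFormula j P' Q') :
    SameFormula j (fun v => P v → P' v) (fun v => Q v → Q' v) := by
  obtain ⟨φ, h₁, h₂⟩ := h
  obtain ⟨φ', h₁', h₂'⟩ := h'
  exact ⟨φ.imp φ', fun v => by simp [h₁, h₁'], fun v => by simp [h₂, h₂']⟩

theorem and {P P' : (ε → M) → Prop} {Q Q' : (ε → N) → Prop} (h : SameFormula j P Q)
    (h' : SameFormula j P' Q') :
    SameFormula j (fun v => P v ∧ P' v) (fun v => Q v ∧ Q' v) := by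
  obtain ⟨φ, h₁, h₂⟩ := h
  obtain ⟨φ', h₁', h₂'⟩ := h'
  exact ⟨φ ⊓ φ', fun v => by simp [h₁, h₁'], fun v => by simp [h₂, h₂']⟩

theorem exists_block [Finite β] {P : (ε ⊕ β → M) → Prop} {Q : (ε ⊕ β → N) → Prop}
    (h : SameFormula j P Q) :
    SameFormula j (fun v => ∃ w : β → M, P (Sum.elim v w))
      (fun v => ∃ w : β → N, Q (Sum.elim v w)) := by
  obtain ⟨φ, h₁, h₂⟩ := h
  refine ⟨(φ.relabel (Equiv.sumAssoc M ε β).symm).iExs β, fun v => ?_, fun v => ?_⟩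
  · rw [FirstOrder.Language.Formula.realize_iExs]
    refine exists_congr fun w => ?_
    rw [FirstOrder.Language.Formula.realize_relabel, ← h₁]
    refine iff_of_eq (congrArg _ ?_)
    funext i; rcases i with i | i | i <;> rfl
  · rw [FirstOrder.Language.Formula.realize_iExs]
    refine exists_congr fun w => ?_
    rw [FirstOrder.Language.Formula.realize_relabel, ← h₂]
    refine iff_of_eq (congrArg _ ?_)
    funext i; rcases i with i | i | i <;> rfl

theorem all {ι : Type} [Finite ι] {P : ι → (ε → M) → Prop} {Q : ι → (ε → N) → Prop}
    (h : ∀ i, SameFormula j (P i) (Q i)) :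
    SameFormula j (fun v => ∀ i, P i v) (fun v => ∀ i, Q i v) := by
  choose φ h₁ h₂ using h
  exact ⟨FirstOrder.Language.Formula.iInf φ,
    fun v => FirstOrder.Language.Formula.realize_iInf.trans (forall_congr' fun i => h₁ i v),
    fun v => FirstOrder.Language.Formula.realize_iInf.trans (forall_congr' fun i => h₂ i v)⟩

theorem dom (φ : L.Formula α) (f : α → ε) :
    SameFormula j (fun v => φ.Realize (v ∘ f)) (fun v => φ.Realize (v ∘ f)) := by
  refine ⟨φ.relabel (fun i => Sum.inr (f i)), fun v => ?_, fun v => ?_⟩ <;>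
    · rw [FirstOrder.Language.Formula.realize_relabel]; rfl

theorem rel (φ : L.Formula (M ⊕ (α ⊕ β ⊕ γ))) (f : α → ε) (g : β → ε) (k : γ → ε) :
    SameFormula j (fun v => φ.Realize (Sum.elim id (tri (v ∘ f) (v ∘ g) (v ∘ k))))
      (fun v => φ.Realize (Sum.elim j (tri (v ∘ f) (v ∘ g) (v ∘ k)))) := by
  refine ⟨φ.relabel (Sum.map id (Sum.elim f (Sum.elim g k))), fun v => ?_, fun v => ?_⟩ <;>
    · rw [FirstOrder.Language.Formula.realize_relabel]
      refine iff_of_eq (congrArg _ ?_)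
      funext i; rcases i with i | i | i | i <;> rfl

theorem rel₀ (φ : L.Formula (α ⊕ β ⊕ γ)) (f : α → ε) (g : β → ε) (k : γ → ε) :
    SameFormula j (fun v => φ.Realize (tri (v ∘ f) (v ∘ g) (v ∘ k)))
      (fun v => φ.Realize (tri (v ∘ f) (v ∘ g) (v ∘ k))) := by
  refine ⟨φ.relabel (fun i => Sum.inr (Sum.elim f (Sum.elim g k) i)),
    fun v => ?_, fun v => ?_⟩ <;>
    · rw [FirstOrder.Language.Formula.realize_relabel]
      refine iff_of_eq (congrArg _ ?_)
      funext i; rcases i with i | i | i <;> rfl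

theorem eq (f g : α → ε) [Finite α] :
    SameFormula j (fun v => v ∘ f = v ∘ g) (fun v => v ∘ f = v ∘ g) := by
  have : Fintype α := Fintype.ofFinite α
  refine ⟨FirstOrder.Language.Formula.iInf fun i : α => FirstOrder.Language.Term.equal (FirstOrder.Language.Term.var (Sum.inr (f i)) : L.Term (M ⊕ ε))
    (FirstOrder.Language.Term.var (Sum.inr (g i))), fun v => ?_, fun v => ?_⟩ <;>
    · rw [FirstOrder.Language.Formula.realize_iInf]
      refine Iff.trans (forall_congr' fun i => ?_) funext_iff.symm
      rw [FirstOrder.Language.Formula.realize_equal]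
      rfl

theorem mem_params {ι : Type*} [Finite ι] [Finite α] (f : α → ε) (a : ι → α → M) :
    SameFormula j (fun v => ∃ i, a i = v ∘ f) (fun v => ∃ i, j ∘ a i = v ∘ f) := by
  refine ⟨FirstOrder.Language.Formula.iSup fun i => FirstOrder.Language.Formula.iInf fun k : α =>
    FirstOrder.Language.Term.equal (FirstOrder.Language.Term.var (Sum.inl (a i k)) :
      L.Term (M ⊕ ε)) (FirstOrder.Language.Term.var (Sum.inr (f k))), fun v => ?_, fun v => ?_⟩ <;>
    · rw [FirstOrder.Language.Formula.realize_iSup]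
      refine exists_congr fun i => ?_
      rw [FirstOrder.Language.Formula.realize_iInf]
      refine Iff.trans (forall_congr' fun k => ?_) funext_iff.symm
      rw [FirstOrder.Language.Formula.realize_equal]
      rfl

theorem transfer [Finite ε] {P : (ε → M) → Prop} {Q : (ε → N) → Prop} (h : SameFormula j P Q)
    (hP : ∀ v, P v) : ∀ v, Q v := by
  obtain ⟨φ, h₁, h₂⟩ := h
  have key := j.map_formula (φ.iAlls ε) id
  rw [FirstOrder.Language.Formula.realize_iAlls, FirstOrder.Language.Formula.realize_iAlls] at key
  intro v
  exact (h₂ v).1 (key.2 (fun w => (h₁ w).2 (hP w)) v)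

end SameFormula

end Transfer

/-! ### Definable group actions with a definable 2-cocycle, and their interpretation -/

section Interpretation

variable {L : FirstOrder.Language.{u, v}} {M : Type w} {N : Type w'}
variable [L.Structure M] [L.Structure N]
variable {G : Type uG} {A : Type uA} [Group G] [AddCommGroup A] [DistribMulAction G A]

/-- A presentation of `G`, `A` and the action of `G` on `A` as `∅`-definable in `M` (in suitable
Cartesian powers of `M`), and of the 2-cocycle `h` as `B`-definable in `M`: the domains and the
graphs of all operations are given by formulas, those for `G`, `A` and the action being without
parameters, the one for `h` having parameters in `B`. -/
structure DefinableCocycle (L : FirstOrder.Language.{u, v}) {M : Type w} [L.Structure M]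
    (B : Set M) (h : TwoCocycle G A) where
  n : ℕ
  m : ℕ
  coordG : G → Fin n → M
  coordA : A → Fin m → M
  coordG_injective : Function.Injective coordG
  coordA_injective : Function.Injective coordA
  domG : L.Formula (Fin n)
  domA : L.Formula (Fin m)
  mulG : L.Formula (Fin n ⊕ Fin n ⊕ Fin n)
  addA : L.Formula (Fin m ⊕ Fin m ⊕ Fin m)
  act : L.Formula (Fin n ⊕ Fin m ⊕ Fin m)
  coc : L.Formula (B ⊕ (Fin n ⊕ Fin n ⊕ Fin m))
  realize_domG : ∀ v : Fin n → M, domG.Realize v ↔ ∃ g, coordG g = v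
  realize_domA : ∀ v : Fin m → M, domA.Realize v ↔ ∃ a, coordA a = v
  realize_mulG : ∀ g₁ g₂ g₃ : G,
    mulG.Realize (tri (coordG g₁) (coordG g₂) (coordG g₃)) ↔ g₁ * g₂ = g₃
  realize_addA : ∀ a₁ a₂ a₃ : A,
    addA.Realize (tri (coordA a₁) (coordA a₂) (coordA a₃)) ↔ a₁ + a₂ = a₃
  realize_act : ∀ (g : G) (a₁ a₂ : A),
    act.Realize (tri (coordG g) (coordA a₁) (coordA a₂)) ↔ g • a₁ = a₂
  realize_coc : ∀ (g₁ g₂ : G) (a : A),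
    coc.Realize (Sum.elim (fun b : B => (b : M)) (tri (coordG g₁) (coordG g₂) (coordA a)))
      ↔ h g₁ g₂ = a

namespace DefinableCocycle

variable {B : Set M} {h : TwoCocycle G A} (D : DefinableCocycle L B h) (j : M ↪ₑ[L] N)

/-- The interpretation `G*` of `G` in the elementary extension `N` of `M`. -/
def GStar (D : DefinableCocycle L B h) (_j : M ↪ₑ[L] N) : Type w' :=
  {x : Fin D.n → N // D.domG.Realize x}

/-- The interpretation `A*` of `A` in the elementary extension `N` of `M`. -/
def AStar (D : DefinableCocycle L B h) (_j : M ↪ₑ[L] N) : Type w' :=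
  {x : Fin D.m → N // D.domA.Realize x}

/-- The coordinates in `N` of an element of `G*`. -/
def coordGStar (x : D.GStar j) : Fin D.n → N := x.1

/-- The coordinates in `N` of an element of `A*`. -/
def coordAStar (x : D.AStar j) : Fin D.m → N := x.1

/-- The embedding of `G` in `G*`. -/
def embG (g : G) : D.GStar j :=
  ⟨j ∘ D.coordG g, (j.map_formula _ _).2 ((D.realize_domG _).2 ⟨g, rfl⟩)⟩

/-- The embedding of `A` in `A*`. -/
def embA (a : A) : D.AStar j :=
  ⟨j ∘ D.coordA a, (j.map_formula _ _).2 ((D.realize_domA _).2 ⟨a, rfl⟩)⟩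

/-- The graph of the multiplication of `G*`. -/
def MulRel (x y z : D.GStar j) : Prop := D.mulG.Realize (tri x.1 y.1 z.1)

/-- The graph of the addition of `A*`. -/
def AddRel (x y z : D.AStar j) : Prop := D.addA.Realize (tri x.1 y.1 z.1)

/-- The graph of the action of `G*` on `A*`. -/
def ActRel (x : D.GStar j) (y z : D.AStar j) : Prop := D.act.Realize (tri x.1 y.1 z.1)

/-- The graph of the interpretation of the 2-cocycle. -/
def CocRel (x y : D.GStar j) (z : D.AStar j) : Prop :=
  D.coc.Realize (Sum.elim (fun b : B => j b) (tri x.1 y.1 z.1))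

/-- The formula defining the 2-cocycle, as a formula with parameters in `M`. -/
def cocM : L.Formula (M ⊕ (Fin D.n ⊕ Fin D.n ⊕ Fin D.m)) :=
  D.coc.relabel (Sum.map Subtype.val id)

theorem realize_cocM (g₁ g₂ : G) (a : A) :
    D.cocM.Realize (Sum.elim id (tri (D.coordG g₁) (D.coordG g₂) (D.coordA a)))
      ↔ h g₁ g₂ = a := by
  rw [cocM, FirstOrder.Language.Formula.realize_relabel, ← D.realize_coc]
  refine iff_of_eq (congrArg _ ?_)
  funext i; rcases i with i | i <;> rfl

theorem cocRel_iff (x y : D.GStar j) (z : D.AStar j) :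
    D.CocRel j x y z ↔ D.cocM.Realize (Sum.elim j (tri x.1 y.1 z.1)) := by
  rw [cocM, FirstOrder.Language.Formula.realize_relabel, CocRel]
  refine iff_of_eq (congrArg _ ?_)
  funext i; rcases i with i | i <;> rfl

section Blocks

variable {n m p q : ℕ}

/-- The `i`-th block of variables of length `n`. -/
def gb (i : Fin p) : Fin n → (Fin p × Fin n) ⊕ (Fin q × Fin m) := fun k => Sum.inl (i, k)

/-- The `i`-th block of variables of length `m`. -/
def ab (i : Fin q) : Fin m → (Fin p × Fin n) ⊕ (Fin q × Fin m) := fun k => Sum.inr (i, k)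

/-- The assignment given by a list of `n`-tuples and a list of `m`-tuples. -/
def asg {K : Type*} (x : Fin p → Fin n → K) (y : Fin q → Fin m → K) :
    (Fin p × Fin n) ⊕ (Fin q × Fin m) → K :=
  Sum.elim (fun i => x i.1 i.2) (fun i => y i.1 i.2)

end Blocks

@[simp]
theorem asg_gb {K : Type*} {n m p q : ℕ} (x : Fin p → Fin n → K) (y : Fin q → Fin m → K)
    (i : Fin p) : asg x y ∘ gb i = x i := rfl

@[simp]
theorem asg_ab {K : Type*} {n m p q : ℕ} (x : Fin p → Fin n → K) (y : Fin q → Fin m → K)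
    (i : Fin q) : asg x y ∘ ab i = y i := rfl

/-- The assignment `v` takes values in the interpretations of `G` and `A`. -/
def IsAdmissible {K : Type*} [L.Structure K] {p q : ℕ}
    (v : (Fin p × Fin D.n) ⊕ (Fin q × Fin D.m) → K) : Prop :=
  (∀ i, D.domG.Realize (v ∘ gb i)) ∧ ∀ i, D.domA.Realize (v ∘ ab i)

variable {j} in
theorem sameFormula_isAdmissible {p q : ℕ} :
    SameFormula j (D.IsAdmissible (K := M) (p := p) (q := q)) D.IsAdmissible :=
  (SameFormula.all fun i => SameFormula.dom D.domG (gb i)).and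
    (SameFormula.all fun i => SameFormula.dom D.domA (ab i))

variable {j} in
theorem transferAll {p q : ℕ} {P : ((Fin p × Fin D.n) ⊕ (Fin q × Fin D.m) → M) → Prop}
    {Q : ((Fin p × Fin D.n) ⊕ (Fin q × Fin D.m) → N) → Prop} (H : SameFormula j P Q)
    (hP : ∀ (g : Fin p → G) (a : Fin q → A),
      P (asg (fun i => D.coordG (g i)) (fun i => D.coordA (a i))))
    (x : Fin p → D.GStar j) (y : Fin q → D.AStar j) :
    Q (asg (fun i => (x i).1) (fun i => (y i).1)) := by
  refine (D.sameFormula_isAdmissible.imp H).transfer ?_ _ ⟨fun i => (x i).2, fun i => (y i).2⟩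
  rintro v ⟨h₁, h₂⟩
  choose g hg using fun i => (D.realize_domG _).1 (h₁ i)
  choose a ha using fun i => (D.realize_domA _).1 (h₂ i)
  convert hP g a using 1
  funext k
  rcases k with ⟨i, k⟩ | ⟨i, k⟩
  · exact (congrFun (hg i) k).symm
  · exact (congrFun (ha i) k).symm

theorem mulRel_total (x : D.GStar j) (y : D.GStar j) :
    ∃ z, D.MulRel j x y z := by
  have T := D.transferAll (p := 2) (q := 0) (j := j)
    (((SameFormula.dom D.domG Sum.inr).and
      (SameFormula.rel₀ D.mulG (Sum.inl ∘ gb 0) (Sum.inl ∘ gb 1) Sum.inr)).exists_block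
        (β := Fin D.n))
    (by
      intro g a
      exact ⟨_, (D.realize_domG _).2 ⟨(g 0 * g 1), rfl⟩, (D.realize_mulG (g 0) (g 1) (g 0 * g 1)).2 rfl⟩)
    ![x, y] ![]
  obtain ⟨z, hz, hz'⟩ := T
  exact ⟨⟨z, hz⟩, hz'⟩

theorem mulRel_unique {x y z w : D.GStar j} (r1 : D.MulRel j x y z)
    (r2 : D.MulRel j x y w) :
    z = w := by
  have T := D.transferAll (p := 4) (q := 0) (j := j)
    (((SameFormula.rel₀ D.mulG (gb 0) (gb 1) (gb 2))).imp
      (((SameFormula.rel₀ D.mulG (gb 0) (gb 1) (gb 3))).imp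
      (SameFormula.eq (gb 2) (gb 3))))
    (by
      intro g a
      simp only [asg_gb, D.realize_mulG, D.coordG_injective.eq_iff]
      intro r1 r2
      rw [← r1, ← r2])
    ![x, y, z, w] ![]
  exact Subtype.ext (T r1 r2)

theorem addRel_total (x : D.AStar j) (y : D.AStar j) :
    ∃ z, D.AddRel j x y z := by
  have T := D.transferAll (p := 0) (q := 2) (j := j)
    (((SameFormula.dom D.domA Sum.inr).and
      (SameFormula.rel₀ D.addA (Sum.inl ∘ ab 0) (Sum.inl ∘ ab 1) Sum.inr)).exists_block
        (β := Fin D.m))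
    (by
      intro g a
      exact ⟨_, (D.realize_domA _).2 ⟨(a 0 + a 1), rfl⟩, (D.realize_addA (a 0) (a 1) (a 0 + a 1)).2 rfl⟩)
    ![] ![x, y]
  obtain ⟨z, hz, hz'⟩ := T
  exact ⟨⟨z, hz⟩, hz'⟩

theorem addRel_unique {x y z w : D.AStar j} (r1 : D.AddRel j x y z)
    (r2 : D.AddRel j x y w) :
    z = w := by
  have T := D.transferAll (p := 0) (q := 4) (j := j)
    (((SameFormula.rel₀ D.addA (ab 0) (ab 1) (ab 2))).imp
      (((SameFormula.rel₀ D.addA (ab 0) (ab 1) (ab 3))).imp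
      (SameFormula.eq (ab 2) (ab 3))))
    (by
      intro g a
      simp only [asg_ab, D.realize_addA, D.coordA_injective.eq_iff]
      intro r1 r2
      rw [← r1, ← r2])
    ![] ![x, y, z, w]
  exact Subtype.ext (T r1 r2)

theorem actRel_total (x : D.GStar j) (y : D.AStar j) :
    ∃ z, D.ActRel j x y z := by
  have T := D.transferAll (p := 1) (q := 1) (j := j)
    (((SameFormula.dom D.domA Sum.inr).and
      (SameFormula.rel₀ D.act (Sum.inl ∘ gb 0) (Sum.inl ∘ ab 0) Sum.inr)).exists_block
        (β := Fin D.m))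
    (by
      intro g a
      exact ⟨_, (D.realize_domA _).2 ⟨(g 0 • a 0), rfl⟩, (D.realize_act (g 0) (a 0) (g 0 • a 0)).2 rfl⟩)
    ![x] ![y]
  obtain ⟨z, hz, hz'⟩ := T
  exact ⟨⟨z, hz⟩, hz'⟩

theorem actRel_unique {x : D.GStar j} {y z w : D.AStar j} (r1 : D.ActRel j x y z)
    (r2 : D.ActRel j x y w) :
    z = w := by
  have T := D.transferAll (p := 1) (q := 3) (j := j)
    (((SameFormula.rel₀ D.act (gb 0) (ab 0) (ab 1))).imp
      (((SameFormula.rel₀ D.act (gb 0) (ab 0) (ab 2))).imp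
      (SameFormula.eq (ab 1) (ab 2))))
    (by
      intro g a
      simp only [asg_gb, asg_ab, D.realize_act, D.coordA_injective.eq_iff]
      intro r1 r2
      rw [← r1, ← r2])
    ![x] ![y, z, w]
  exact Subtype.ext (T r1 r2)

theorem cocRel_total (x : D.GStar j) (y : D.GStar j) :
    ∃ z, D.CocRel j x y z := by
  have T := D.transferAll (p := 2) (q := 0) (j := j)
    (((SameFormula.dom D.domA Sum.inr).and
      (SameFormula.rel D.cocM (Sum.inl ∘ gb 0) (Sum.inl ∘ gb 1) Sum.inr)).exists_block
        (β := Fin D.m))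
    (by
      intro g a
      exact ⟨_, (D.realize_domA _).2 ⟨(h (g 0) (g 1)), rfl⟩, (D.realize_cocM (g 0) (g 1) (h (g 0) (g 1))).2 rfl⟩)
    ![x, y] ![]
  obtain ⟨z, hz, hz'⟩ := T
  exact ⟨⟨z, hz⟩, (D.cocRel_iff j _ _ _).2 hz'⟩

theorem cocRel_unique {x y : D.GStar j} {z w : D.AStar j} (r1 : D.CocRel j x y z)
    (r2 : D.CocRel j x y w) :
    z = w := by
  have T := D.transferAll (p := 2) (q := 2) (j := j)
    (((SameFormula.rel D.cocM (gb 0) (gb 1) (ab 0))).imp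
      (((SameFormula.rel D.cocM (gb 0) (gb 1) (ab 1))).imp
      (SameFormula.eq (ab 0) (ab 1))))
    (by
      intro g a
      simp only [asg_gb, asg_ab, D.realize_cocM, D.coordA_injective.eq_iff]
      intro r1 r2
      rw [← r1, ← r2])
    ![x, y] ![z, w]
  exact Subtype.ext (T ((D.cocRel_iff j _ _ _).1 r1) ((D.cocRel_iff j _ _ _).1 r2))

theorem mulRel_assoc {x y z u w r : D.GStar j} (r1 : D.MulRel j x y u)
    (r2 : D.MulRel j u z w)
    (r3 : D.MulRel j y z r) :
    D.MulRel j x r w := by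
  have T := D.transferAll (p := 6) (q := 0) (j := j)
    (((SameFormula.rel₀ D.mulG (gb 0) (gb 1) (gb 3))).imp
      (((SameFormula.rel₀ D.mulG (gb 3) (gb 2) (gb 4))).imp
      (((SameFormula.rel₀ D.mulG (gb 1) (gb 2) (gb 5))).imp
      (SameFormula.rel₀ D.mulG (gb 0) (gb 5) (gb 4)))))
    (by
      intro g a
      simp only [asg_gb, D.realize_mulG]
      intro r1 r2 r3
      rw [← r2, ← r1, ← r3, mul_assoc])
    ![x, y, z, u, w, r] ![]
  exact T r1 r2 r3

theorem mulRel_one {e x : D.GStar j} (r1 : D.MulRel j e e e) :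
    D.MulRel j e x x := by
  have T := D.transferAll (p := 2) (q := 0) (j := j)
    (((SameFormula.rel₀ D.mulG (gb 0) (gb 0) (gb 0))).imp
      (SameFormula.rel₀ D.mulG (gb 0) (gb 1) (gb 1)))
    (by
      intro g a
      simp only [asg_gb, D.realize_mulG]
      intro r1
      rw [mul_eq_left.1 r1, one_mul])
    ![e, x] ![]
  exact T r1

theorem addRel_assoc {x y z u w r : D.AStar j} (r1 : D.AddRel j x y u)
    (r2 : D.AddRel j u z w)
    (r3 : D.AddRel j y z r) :
    D.AddRel j x r w := by
  have T := D.transferAll (p := 0) (q := 6) (j := j)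
    (((SameFormula.rel₀ D.addA (ab 0) (ab 1) (ab 3))).imp
      (((SameFormula.rel₀ D.addA (ab 3) (ab 2) (ab 4))).imp
      (((SameFormula.rel₀ D.addA (ab 1) (ab 2) (ab 5))).imp
      (SameFormula.rel₀ D.addA (ab 0) (ab 5) (ab 4)))))
    (by
      intro g a
      simp only [asg_ab, D.realize_addA]
      intro r1 r2 r3
      rw [← r2, ← r1, ← r3, add_assoc])
    ![] ![x, y, z, u, w, r]
  exact T r1 r2 r3

theorem addRel_zero {e x : D.AStar j} (r1 : D.AddRel j e e e) :
    D.AddRel j e x x := by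
  have T := D.transferAll (p := 0) (q := 2) (j := j)
    (((SameFormula.rel₀ D.addA (ab 0) (ab 0) (ab 0))).imp
      (SameFormula.rel₀ D.addA (ab 0) (ab 1) (ab 1)))
    (by
      intro g a
      simp only [asg_ab, D.realize_addA]
      intro r1
      rw [add_eq_left.1 r1, zero_add])
    ![] ![e, x]
  exact T r1

theorem addRel_comm {x y z : D.AStar j} (r1 : D.AddRel j x y z) :
    D.AddRel j y x z := by
  have T := D.transferAll (p := 0) (q := 3) (j := j)
    (((SameFormula.rel₀ D.addA (ab 0) (ab 1) (ab 2))).imp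
      (SameFormula.rel₀ D.addA (ab 1) (ab 0) (ab 2)))
    (by
      intro g a
      simp only [asg_ab, D.realize_addA]
      intro r1
      rw [← r1, add_comm])
    ![] ![x, y, z]
  exact T r1

theorem actRel_one {e : D.GStar j} {y : D.AStar j} (r1 : D.MulRel j e e e) :
    D.ActRel j e y y := by
  have T := D.transferAll (p := 1) (q := 1) (j := j)
    (((SameFormula.rel₀ D.mulG (gb 0) (gb 0) (gb 0))).imp
      (SameFormula.rel₀ D.act (gb 0) (ab 0) (ab 0)))
    (by
      intro g a
      simp only [asg_gb, asg_ab, D.realize_mulG, D.realize_act]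
      intro r1
      rw [mul_eq_left.1 r1, one_smul])
    ![e] ![y]
  exact T r1

theorem actRel_mul {x y u : D.GStar j} {s t r : D.AStar j} (r1 : D.MulRel j x y u)
    (r2 : D.ActRel j y s t)
    (r3 : D.ActRel j x t r) :
    D.ActRel j u s r := by
  have T := D.transferAll (p := 3) (q := 3) (j := j)
    (((SameFormula.rel₀ D.mulG (gb 0) (gb 1) (gb 2))).imp
      (((SameFormula.rel₀ D.act (gb 1) (ab 0) (ab 1))).imp
      (((SameFormula.rel₀ D.act (gb 0) (ab 1) (ab 2))).imp
      (SameFormula.rel₀ D.act (gb 2) (ab 0) (ab 2)))))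
    (by
      intro g a
      simp only [asg_gb, asg_ab, D.realize_mulG, D.realize_act]
      intro r1 r2 r3
      rw [← r1, ← r3, ← r2, mul_smul])
    ![x, y, u] ![s, t, r]
  exact T r1 r2 r3

theorem actRel_add {x : D.GStar j} {s t u k l r : D.AStar j} (r1 : D.AddRel j s t u)
    (r2 : D.ActRel j x s k)
    (r3 : D.ActRel j x t l)
    (r4 : D.AddRel j k l r) :
    D.ActRel j x u r := by
  have T := D.transferAll (p := 1) (q := 6) (j := j)
    (((SameFormula.rel₀ D.addA (ab 0) (ab 1) (ab 2))).imp
      (((SameFormula.rel₀ D.act (gb 0) (ab 0) (ab 3))).imp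
      (((SameFormula.rel₀ D.act (gb 0) (ab 1) (ab 4))).imp
      (((SameFormula.rel₀ D.addA (ab 3) (ab 4) (ab 5))).imp
      (SameFormula.rel₀ D.act (gb 0) (ab 2) (ab 5))))))
    (by
      intro g a
      simp only [asg_gb, asg_ab, D.realize_addA, D.realize_act]
      intro r1 r2 r3 r4
      rw [← r4, ← r1, ← r2, ← r3, smul_add])
    ![x] ![s, t, u, k, l, r]
  exact T r1 r2 r3 r4

theorem actRel_zero {x : D.GStar j} {e : D.AStar j} (r1 : D.AddRel j e e e) :
    D.ActRel j x e e := by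
  have T := D.transferAll (p := 1) (q := 1) (j := j)
    (((SameFormula.rel₀ D.addA (ab 0) (ab 0) (ab 0))).imp
      (SameFormula.rel₀ D.act (gb 0) (ab 0) (ab 0)))
    (by
      intro g a
      simp only [asg_gb, asg_ab, D.realize_addA, D.realize_act]
      intro r1
      rw [add_eq_left.1 r1, smul_zero])
    ![x] ![e]
  exact T r1

theorem cocRel_cocycle {x y z u w : D.GStar j} {k l s t r o : D.AStar j} (r1 : D.MulRel j x y u)
    (r2 : D.MulRel j y z w)
    (r3 : D.CocRel j x y k)
    (r4 : D.CocRel j u z l)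
    (r5 : D.CocRel j x w s)
    (r6 : D.CocRel j y z t)
    (r7 : D.ActRel j x t r)
    (r8 : D.AddRel j k l o) :
    D.AddRel j s r o := by
  have T := D.transferAll (p := 5) (q := 6) (j := j)
    (((SameFormula.rel₀ D.mulG (gb 0) (gb 1) (gb 3))).imp
      (((SameFormula.rel₀ D.mulG (gb 1) (gb 2) (gb 4))).imp
      (((SameFormula.rel D.cocM (gb 0) (gb 1) (ab 0))).imp
      (((SameFormula.rel D.cocM (gb 3) (gb 2) (ab 1))).imp
      (((SameFormula.rel D.cocM (gb 0) (gb 4) (ab 2))).imp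
      (((SameFormula.rel D.cocM (gb 1) (gb 2) (ab 3))).imp
      (((SameFormula.rel₀ D.act (gb 0) (ab 3) (ab 4))).imp
      (((SameFormula.rel₀ D.addA (ab 0) (ab 1) (ab 5))).imp
      (SameFormula.rel₀ D.addA (ab 2) (ab 4) (ab 5))))))))))
    (by
      intro g a
      simp only [asg_gb, asg_ab, D.realize_mulG, D.realize_addA, D.realize_act, D.realize_cocM]
      intro r1 r2 r3 r4 r5 r6 r7 r8
      rw [← r8, ← r7, ← r6, ← r5, ← r4, ← r3, ← r2, ← r1, h.cocycle'])
    ![x, y, z, u, w] ![k, l, s, t, r, o]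
  exact T r1 r2 ((D.cocRel_iff j _ _ _).1 r3) ((D.cocRel_iff j _ _ _).1 r4) ((D.cocRel_iff j _ _ _).1 r5) ((D.cocRel_iff j _ _ _).1 r6) r7 r8

theorem cocRel_one_right {x e : D.GStar j} {o : D.AStar j} (r1 : D.MulRel j e e e)
    (r2 : D.AddRel j o o o) :
    D.CocRel j x e o := by
  have T := D.transferAll (p := 2) (q := 1) (j := j)
    (((SameFormula.rel₀ D.mulG (gb 1) (gb 1) (gb 1))).imp
      (((SameFormula.rel₀ D.addA (ab 0) (ab 0) (ab 0))).imp
      (SameFormula.rel D.cocM (gb 0) (gb 1) (ab 0))))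
    (by
      intro g a
      simp only [asg_gb, asg_ab, D.realize_mulG, D.realize_addA, D.realize_cocM]
      intro r1 r2
      rw [mul_eq_left.1 r1, add_eq_left.1 r2, h.map_one_right'])
    ![x, e] ![o]
  exact (D.cocRel_iff j _ _ _).2 (T r1 r2)

theorem cocRel_one_left {x e : D.GStar j} {o : D.AStar j} (r1 : D.MulRel j e e e)
    (r2 : D.AddRel j o o o) :
    D.CocRel j e x o := by
  have T := D.transferAll (p := 2) (q := 1) (j := j)
    (((SameFormula.rel₀ D.mulG (gb 1) (gb 1) (gb 1))).imp
      (((SameFormula.rel₀ D.addA (ab 0) (ab 0) (ab 0))).imp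
      (SameFormula.rel D.cocM (gb 1) (gb 0) (ab 0))))
    (by
      intro g a
      simp only [asg_gb, asg_ab, D.realize_mulG, D.realize_addA, D.realize_cocM]
      intro r1 r2
      rw [mul_eq_left.1 r1, add_eq_left.1 r2, h.map_one_left'])
    ![x, e] ![o]
  exact (D.cocRel_iff j _ _ _).2 (T r1 r2)

theorem mulRel_inv {e : D.GStar j} (x : D.GStar j) (r : D.MulRel j e e e) :
    ∃ y, D.MulRel j y x e := by
  have T := D.transferAll (p := 2) (q := 0) (j := j)
    ((SameFormula.rel₀ D.mulG (gb 0) (gb 0) (gb 0)).imp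
      ((SameFormula.dom D.domG Sum.inr).and (SameFormula.rel₀ D.mulG Sum.inr (Sum.inl ∘ gb 1)
        (Sum.inl ∘ gb 0))).exists_block)
    (by
      intro g a r1
      simp only [asg_gb, D.realize_mulG] at r1
      refine ⟨_, (D.realize_domG _).2 ⟨(g 1)⁻¹, rfl⟩, (D.realize_mulG ((g 1)⁻¹) (g 1) (g 0)).2 ?_⟩
      rw [mul_eq_left.1 r1, inv_mul_cancel])
    ![e, x] ![]
  obtain ⟨z, hz, hz'⟩ := T r
  exact ⟨⟨z, hz⟩, hz'⟩

theorem addRel_neg {e : D.AStar j} (x : D.AStar j) (r : D.AddRel j e e e) :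
    ∃ y, D.AddRel j y x e := by
  have T := D.transferAll (p := 0) (q := 2) (j := j)
    ((SameFormula.rel₀ D.addA (ab 0) (ab 0) (ab 0)).imp
      ((SameFormula.dom D.domA Sum.inr).and (SameFormula.rel₀ D.addA Sum.inr (Sum.inl ∘ ab 1)
        (Sum.inl ∘ ab 0))).exists_block)
    (by
      intro g a r1
      simp only [asg_ab, D.realize_addA] at r1
      refine ⟨_, (D.realize_domA _).2 ⟨-(a 1), rfl⟩, (D.realize_addA (-(a 1)) (a 1) (a 0)).2 ?_⟩
      rw [add_eq_left.1 r1, neg_add_cancel])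
    ![] ![e, x]
  obtain ⟨z, hz, hz'⟩ := T r
  exact ⟨⟨z, hz⟩, hz'⟩

/-- Multiplication on `G*`. -/
instance : Mul (D.GStar j) := ⟨fun x y => (D.mulRel_total j x y).choose⟩

theorem mulRel_iff {x y z : D.GStar j} : D.MulRel j x y z ↔ x * y = z := by
  have H : D.MulRel j x y (x * y) := (D.mulRel_total j x y).choose_spec
  exact ⟨fun h' => D.mulRel_unique j H h', fun h' => h' ▸ H⟩

instance : One (D.GStar j) := ⟨D.embG j 1⟩

theorem mulRel_emb (g₁ g₂ : G) :
    D.MulRel j (D.embG j g₁) (D.embG j g₂) (D.embG j (g₁ * g₂)) := by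
  have := (j.map_formula D.mulG _).2 ((D.realize_mulG g₁ g₂ _).2 rfl)
  rwa [tri_comp] at this

theorem mulRel_one_one : D.MulRel j 1 1 1 := by
  have := D.mulRel_emb j 1 1
  rwa [mul_one] at this

instance : Inv (D.GStar j) := ⟨fun x => (D.mulRel_inv j x (D.mulRel_one_one j)).choose⟩

/-- The group structure of `G*`, given by the formula defining the multiplication of `G`. -/
instance : Group (D.GStar j) :=
  Group.ofLeftAxioms
    (fun _ _ _ => ((D.mulRel_iff j).1 (D.mulRel_assoc j ((D.mulRel_iff j).2 rfl)
      ((D.mulRel_iff j).2 rfl) ((D.mulRel_iff j).2 rfl))).symm)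
    (fun _ => (D.mulRel_iff j).1 (D.mulRel_one j (D.mulRel_one_one j)))
    (fun x => (D.mulRel_iff j).1 (D.mulRel_inv j x (D.mulRel_one_one j)).choose_spec)

/-- Addition on `A*`. -/
instance : Add (D.AStar j) := ⟨fun x y => (D.addRel_total j x y).choose⟩

theorem addRel_iff {x y z : D.AStar j} : D.AddRel j x y z ↔ x + y = z := by
  have H : D.AddRel j x y (x + y) := (D.addRel_total j x y).choose_spec
  exact ⟨fun h' => D.addRel_unique j H h', fun h' => h' ▸ H⟩

instance : Zero (D.AStar j) := ⟨D.embA j 0⟩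

theorem addRel_emb (a₁ a₂ : A) :
    D.AddRel j (D.embA j a₁) (D.embA j a₂) (D.embA j (a₁ + a₂)) := by
  have := (j.map_formula D.addA _).2 ((D.realize_addA a₁ a₂ _).2 rfl)
  rwa [tri_comp] at this

theorem addRel_zero_zero : D.AddRel j 0 0 0 := by
  have := D.addRel_emb j 0 0
  rwa [add_zero] at this

instance : Neg (D.AStar j) := ⟨fun x => (D.addRel_neg j x (D.addRel_zero_zero j)).choose⟩

/-- The group structure of `A*`, given by the formula defining the addition of `A`. -/
instance : AddCommGroup (D.AStar j) :=
  { AddGroup.ofLeftAxioms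
      (fun _ _ _ => ((D.addRel_iff j).1 (D.addRel_assoc j ((D.addRel_iff j).2 rfl)
        ((D.addRel_iff j).2 rfl) ((D.addRel_iff j).2 rfl))).symm)
      (fun _ => (D.addRel_iff j).1 (D.addRel_zero j (D.addRel_zero_zero j)))
      (fun x => (D.addRel_iff j).1 (D.addRel_neg j x (D.addRel_zero_zero j)).choose_spec) with
    add_comm := fun _ _ =>
      ((D.addRel_iff j).1 (D.addRel_comm j ((D.addRel_iff j).2 rfl))).symm }

instance : SMul (D.GStar j) (D.AStar j) := ⟨fun x y => (D.actRel_total j x y).choose⟩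

theorem actRel_iff {x : D.GStar j} {y z : D.AStar j} : D.ActRel j x y z ↔ x • y = z := by
  have H : D.ActRel j x y (x • y) := (D.actRel_total j x y).choose_spec
  exact ⟨fun h' => D.actRel_unique j H h', fun h' => h' ▸ H⟩

/-- The action of `G*` on `A*`, given by the formula defining the action of `G` on `A`. -/
instance : DistribMulAction (D.GStar j) (D.AStar j) where
  one_smul _ := (D.actRel_iff j).1 (D.actRel_one j (D.mulRel_one_one j))
  mul_smul _ _ _ := (D.actRel_iff j).1 (D.actRel_mul j ((D.mulRel_iff j).2 rfl)
    ((D.actRel_iff j).2 rfl) ((D.actRel_iff j).2 rfl))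
  smul_zero _ := (D.actRel_iff j).1 (D.actRel_zero j (D.addRel_zero_zero j))
  smul_add _ _ _ := (D.actRel_iff j).1 (D.actRel_add j ((D.addRel_iff j).2 rfl)
    ((D.actRel_iff j).2 rfl) ((D.actRel_iff j).2 rfl) ((D.addRel_iff j).2 rfl))

/-- The values of the interpretation of the 2-cocycle. -/
def cocFun (x y : D.GStar j) : D.AStar j := (D.cocRel_total j x y).choose

theorem cocRel_iff_eq {x y : D.GStar j} {z : D.AStar j} :
    D.CocRel j x y z ↔ D.cocFun j x y = z := by
  have H : D.CocRel j x y (D.cocFun j x y) := (D.cocRel_total j x y).choose_spec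
  exact ⟨fun h' => D.cocRel_unique j H h', fun h' => h' ▸ H⟩

/-- The 2-cocycle `h* : G* × G* → A*`, given by the formula defining `h`. -/
def hStar : TwoCocycle (D.GStar j) (D.AStar j) where
  toFun := D.cocFun j
  cocycle' _ _ _ := ((D.addRel_iff j).1 (D.cocRel_cocycle j ((D.mulRel_iff j).2 rfl)
    ((D.mulRel_iff j).2 rfl) ((D.cocRel_iff_eq j).2 rfl) ((D.cocRel_iff_eq j).2 rfl)
    ((D.cocRel_iff_eq j).2 rfl) ((D.cocRel_iff_eq j).2 rfl) ((D.actRel_iff j).2 rfl)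
    ((D.addRel_iff j).2 rfl))).symm
  map_one_right' _ := (D.cocRel_iff_eq j).1
    (D.cocRel_one_right j (D.mulRel_one_one j) (D.addRel_zero_zero j))
  map_one_left' _ := (D.cocRel_iff_eq j).1
    (D.cocRel_one_left j (D.mulRel_one_one j) (D.addRel_zero_zero j))

theorem hStar_emb (g₁ g₂ : G) :
    D.hStar j (D.embG j g₁) (D.embG j g₂) = D.embA j (h g₁ g₂) := by
  refine (D.cocRel_iff_eq j).1 ((D.cocRel_iff j _ _ _).2 ?_)
  have := (j.map_formula D.cocM _).2 ((D.realize_cocM g₁ g₂ _).2 rfl)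
  rwa [Sum.comp_elim, tri_comp, Function.comp_id] at this

/-- If `im(h)` is finite, then `im(h*) = im(h)`; hence the subgroup of `A*` generated by `im(h*)`
is the subgroup `A₀` of `A` generated by `im(h)`. -/
theorem image_hStar (hfin : h.image.Finite) :
    (D.hStar j).image = D.embA j '' h.image := by
  have : Finite h.image := hfin
  ext z
  constructor
  · rintro ⟨x, y, rfl⟩
    have T := D.transferAll (p := 2) (q := 1) (j := j)
      ((SameFormula.rel D.cocM (gb 0) (gb 1) (ab 0)).imp
        (SameFormula.mem_params (ab 0) fun i : h.image => D.coordA i))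
      (by
        intro g a r
        simp only [asg_gb, asg_ab, D.realize_cocM] at r
        exact ⟨⟨a 0, g 0, g 1, r⟩, rfl⟩)
      ![x, y] ![D.hStar j x y]
    obtain ⟨i, hi⟩ := T ((D.cocRel_iff j _ _ _).1 ((D.cocRel_iff_eq j).2 rfl))
    exact ⟨i, i.2, Subtype.ext hi⟩
  · rintro ⟨_, ⟨g₁, g₂, rfl⟩, rfl⟩
    exact ⟨D.embG j g₁, D.embG j g₂, D.hStar_emb j g₁ g₂⟩

/-- The coordinates in `N` of an element `(a, g)` of the interpretation `A* × G*` of the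
extension. -/
def coordExt (x : CocycleExt (D.hStar j)) : Fin D.m ⊕ Fin D.n → N :=
  Sum.elim (D.coordAStar j x.fst) (D.coordGStar j x.snd)

end DefinableCocycle

/-- Let `X` and `A` sit in Cartesian powers of `N` through the coordinate maps `cX` and `cA`.
A function `f : X → A₀ / (C ∩ A₀)` is `B`-invariant if its graph, viewed as the relation
`f(x) = a + (C ∩ A₀)` between `x ∈ X` and `a ∈ A₀`, is invariant under `Aut(N/B)`. -/
def IsInvariantFunOver (L : FirstOrder.Language.{u, v}) {N : Type w'} [L.Structure N] (B : Set N)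
    {G : Type w'} {A : Type w'} [Group G] [AddCommGroup A] [DistribMulAction G A]
    {X : Type w'} {ι κ : Type} (cX : X → ι → N) (cA : A → κ → N) {h : TwoCocycle G A}
    {C : AddSubgroup A} {hC : C.InvariantUnder G} (f : X → h.Coeff C hC) : Prop :=
  IsInvariantOver L B
    {v : ι ⊕ κ → N | ∃ (x : X) (a : h.imageSubgroup),
      f x = h.toCoeff C hC a ∧ v = Sum.elim (cX x) (cA a)}

end Interpretation

end

/-! Let `K` be a subgroup of the extension, `H` the subgroup of those `a` with `(a, 1) ∈ K`, and `C`
a `G*`-invariant subgroup of `A*` containing `H`. If over each `g` in a subgroup `X` of `G*` there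
is some `(c - a, g) ∈ K` with `c ∈ C` and `a ∈ A₀`, then `a` modulo `C` depends only on `g`, and `g
↦ a` splits the cocycle induced on `X`. Automorphisms over `B` fix `A₀` pointwise, because the image
of `h` lies in `dcl(B)`; so the splitting is `B`-invariant as soon as `K`, `C` and `X` are
(`exists_invariant_split_of_subgroup`). For the same reason the subgroup `E_C` of pairs with first
coordinate in `C + A₀` is `B`-invariant whenever `C` is, and its index is at most that of `C`. No
type-definability of `E_C` is claimed, and the gap between the two components comes from there.

Inequality of the components: if they agreed, `K = X^{00}` would lie in `E_C` for `C = A₁`. It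
projects onto `G*^{00}` by compactness, so a forbidden splitting results once `H ≤ A₁`. Now `H` is
type-definable and contained in `A₁ + A₀`. Thus `(H + A₁)/A₁` behaves like a compact group, yet it
embeds in the finitely generated free group `A₀/(A₁ ∩ A₀)`, so it must vanish.
`le_of_le_sup_imageSubgroup` proves this without topology: compactness gives a limit `x` of the sums
`(1 + 4 + ⋯ + 4^(n-1)) • a`, a 2-adic `-a/3`. Then `3x + a` is divisible by every `4^n`, hence zero
modulo `A₁`. So every element of `H` is divisible by 3 within `H` modulo `A₁`, hence by all powers
of 3, hence is zero.

Equality with the whole extension: a type-definable `K` of bounded index projects onto `G* =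
G*^{000}`, and so does `K ∩ E_H`. If `H` were proper, `C = H` would give a forbidden splitting; so
`H = A*`, and `K` is everything. -/

/-! ### Type-definable sets and compactness in a saturated model. -/

section TypeDefinable

variable {L : FirstOrder.Language.{u, v}} {N : Type w'} [L.Structure N] {P Q : Set N}

theorem Set.Definable.isTypeDefinableOver {ι : Type x} {S : Set (ι → N)} (hS : P.Definable L S) :
    IsTypeDefinableOver L P S :=
  ⟨{S}, by simpa using hS, by simp⟩

theorem Set.Definable.realize_formula (φ : L.Formula ι) : P.Definable L {v : ι → N | φ.Realize v} :=
  (Set.empty_definable_iff.2 ⟨φ, rfl⟩).mono (Set.empty_subset P)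

namespace IsTypeDefinableOver

theorem iInter {ι : Type x} {I : Sort*} {F : I → Set (ι → N)}
    (hF : ∀ i, IsTypeDefinableOver L P (F i)) : IsTypeDefinableOver L P (⋂ i, F i) := by
  choose 𝒟 h₁ h₂ using hF
  refine ⟨⋃ i, 𝒟 i, ?_, ?_⟩
  · simpa using fun D i hD => h₁ i D hD
  · rw [Set.sInter_iUnion]
    exact Set.iInter_congr h₂

theorem inter {ι : Type x} {S T : Set (ι → N)} (hS : IsTypeDefinableOver L P S)
    (hT : IsTypeDefinableOver L P T) : IsTypeDefinableOver L P (S ∩ T) := by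
  rw [Set.inter_eq_iInter]
  exact iInter fun b => by cases b <;> assumption

theorem mono {ι : Type x} {S : Set (ι → N)} (hS : IsTypeDefinableOver L P S) (hPQ : P ⊆ Q) :
    IsTypeDefinableOver L Q S := by
  obtain ⟨𝒟, h₁, h₂⟩ := hS
  exact ⟨𝒟, fun D hD => (h₁ D hD).mono hPQ, h₂⟩

theorem preimage_comp {α : Type x} {β : Type x} (f : α → β) {S : Set (α → N)}
    (hS : IsTypeDefinableOver L P S) : IsTypeDefinableOver L P {v : β → N | v ∘ f ∈ S} := by
  obtain ⟨𝒟, h₁, rfl⟩ := hS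
  refine ⟨(fun D => {v : β → N | v ∘ f ∈ D}) '' 𝒟, ?_, ?_⟩
  · rintro _ ⟨D, hD, rfl⟩
    exact (h₁ D hD).preimage_comp f
  · ext v
    simp

theorem isInvariantOver {ι : Type x} {S : Set (ι → N)} (hS : IsTypeDefinableOver L P S) :
    IsInvariantOver L P S := by
  obtain ⟨𝒟, h₁, rfl⟩ := hS
  intro σ hσ a ha D hD
  have haD := ha D hD
  obtain ⟨φ, rfl⟩ := Set.definable_iff_exists_formula_sum.1 (h₁ D hD)
  rw [Set.mem_ofPred_eq] at haD ⊢
  rw [← FirstOrder.Language.StrongHomClass.realize_formula σ] at haD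
  convert haD using 1
  funext i
  rcases i with i | i
  · exact (hσ i i.2).symm
  · rfl

end IsTypeDefinableOver

theorem Set.Definable.fiber {α β : Type} {D : Set (α ⊕ β → N)} (hD : P.Definable L D)
    (v : α → N) : (P ∪ Set.range v).Definable L {w : β → N | Sum.elim v w ∈ D} := by
  obtain ⟨φ, rfl⟩ := Set.definable_iff_exists_formula_sum.1 hD
  refine Set.definable_iff_exists_formula_sum.2 ⟨φ.relabel (Sum.elim
    (fun p => Sum.inl ⟨p.1, Or.inl p.2⟩)
    (Sum.elim (fun i => Sum.inl ⟨v i, Or.inr ⟨i, rfl⟩⟩) Sum.inr)), ?_⟩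
  ext w
  rw [Set.mem_ofPred_eq, Set.mem_ofPred_eq, Set.mem_ofPred_eq,
    FirstOrder.Language.Formula.realize_relabel]
  refine iff_of_eq (congrArg _ ?_)
  funext i
  rcases i with i | i | i <;> rfl

theorem IsTypeDefinableOver.fiber {α β : Type} {S : Set (α ⊕ β → N)}
    (hS : IsTypeDefinableOver L P S) (v : α → N) :
    IsTypeDefinableOver L (P ∪ Set.range v) {w : β → N | Sum.elim v w ∈ S} := by
  obtain ⟨𝒟, h₁, rfl⟩ := hS
  refine ⟨(fun D => {w : β → N | Sum.elim v w ∈ D}) '' 𝒟, ?_, ?_⟩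
  · rintro _ ⟨D, hD, rfl⟩
    exact (h₁ D hD).fiber v
  · ext v
    simp

variable {κ : Cardinal.{w'}}

theorem IsSaturatedModel.nonempty_sInter (hN : IsSaturatedModel L N κ) (hP : #P < κ)
    {ι : Type} [Finite ι] {𝒟 : Set (Set (ι → N))} (h𝒟 : ∀ D ∈ 𝒟, P.Definable L D)
    (hfip : ∀ 𝒬 ⊆ 𝒟, 𝒬.Finite → (⋂₀ 𝒬).Nonempty) : (⋂₀ 𝒟).Nonempty := by
  obtain ⟨k, ⟨e⟩⟩ := Finite.exists_equiv_fin ι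
  obtain ⟨a, ha⟩ := hN P hP k {φ | {v | φ.Realize (v ∘ e.symm)} ∈ 𝒟} (by
    intro q hq hfin
    obtain ⟨v, hv⟩ := hfip ((fun φ : L[[P]].Formula (Fin k) => {v | φ.Realize (v ∘ e.symm)}) '' q)
      (by rintro _ ⟨φ, hφ, rfl⟩; exact hq hφ) (hfin.image _)
    exact ⟨v ∘ e.symm, fun φ hφ => hv _ ⟨φ, hφ, rfl⟩⟩)
  refine ⟨a ∘ e, fun D hD => ?_⟩
  obtain ⟨φ, rfl⟩ := h𝒟 D hD
  refine FirstOrder.Language.Formula.realize_relabel.1 (ha (φ.relabel e) ?_)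
  rw [Set.mem_ofPred_eq]
  convert hD using 2
  ext v
  rw [FirstOrder.Language.Formula.realize_relabel, Function.comp_assoc, e.symm_comp_self,
    Function.comp_id]

theorem IsSaturatedModel.nonempty_iInter (hN : IsSaturatedModel L N κ) (hP : #P < κ)
    {ι : Type} [Finite ι] {I : Type*} {F : I → Set (ι → N)}
    (hF : ∀ i, IsTypeDefinableOver L P (F i))
    (hfip : ∀ t : Finset I, (⋂ i ∈ t, F i).Nonempty) : (⋂ i, F i).Nonempty := by
  classical
  choose 𝒟 h₁ h₂ using hF
  have : (⋂ i, F i) = ⋂₀ ⋃ i, 𝒟 i := by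
    rw [Set.sInter_iUnion]
    exact Set.iInter_congr h₂
  rw [this]
  refine hN.nonempty_sInter hP (by simpa using fun D i hD => h₁ i D hD) fun 𝒬 h𝒬 hfin => ?_
  have h𝒬' : ∀ D : 𝒬, ∃ i, (D : Set (ι → N)) ∈ 𝒟 i := fun D => Set.mem_iUnion.1 (h𝒬 D.2)
  choose f hf using h𝒬'
  have := hfin.to_subtype
  have := Fintype.ofFinite 𝒬
  refine (hfip (Finset.univ.image f)).mono fun v hv D hD => ?_
  have h₃ : v ∈ F (f ⟨D, hD⟩) :=
    Set.mem_iInter₂.1 hv _ (Finset.mem_image_of_mem f (Finset.mem_univ _))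
  rw [h₂] at h₃
  exact h₃ D (hf ⟨D, hD⟩)

/-- A directed version of compactness. -/
theorem IsSaturatedModel.nonempty_iInter_of_directed (hN : IsSaturatedModel L N κ) (hP : #P < κ)
    {ι : Type} [Finite ι] {I : Type*} [Nonempty I] {F : I → Set (ι → N)}
    (hF : ∀ i, IsTypeDefinableOver L P (F i)) (hne : ∀ i, (F i).Nonempty)
    (hdir : Directed (· ⊇ ·) F) : (⋂ i, F i).Nonempty := by
  refine hN.nonempty_iInter hP hF fun t => ?_
  obtain ⟨i, hi⟩ := hdir.finset_le t
  exact (hne i).mono (Set.subset_iInter₂ hi)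

theorem mk_union_range_lt (hκ : ℵ₀ < κ) (hP : #P < κ) {α : Type*} [Countable α] (v : α → N) :
    #(P ∪ Set.range v : Set N) < κ :=
  (mk_union_le _ _).trans_lt (add_lt_of_lt hκ.le hP
    ((Set.countable_range v).le_aleph0.trans_lt hκ))

/-- Saturation exchanges the existential quantifier with the intersection: if every finite subfamily
has a witness over `v`, compactness over the parameters `P` together with `v` gives a common one. -/
theorem IsTypeDefinableOver.exists_block (hN : IsSaturatedModel L N κ) (hκ : ℵ₀ < κ)
    (hP : #P < κ) {α β : Type} [Finite α] [Finite β] {S : Set (α ⊕ β → N)}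
    (hS : IsTypeDefinableOver L P S) :
    IsTypeDefinableOver L P {v : α → N | ∃ w : β → N, Sum.elim v w ∈ S} := by
  obtain ⟨𝒟, h₁, rfl⟩ := hS
  -- Finite intersections are projected, not single members of `𝒟`: separate witnesses for the
  -- members would not give the finite intersection property on the fibre.
  refine ⟨{E | ∃ 𝒬 ⊆ 𝒟, 𝒬.Finite ∧ E = {v | ∃ w : β → N, Sum.elim v w ∈ ⋂₀ 𝒬}}, ?_, ?_⟩
  · rintro _ ⟨𝒬, h𝒬, hfin, rfl⟩
    refine Set.Definable.exists_of_finite ?_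
    have := hfin.to_subtype
    rw [Set.sInter_eq_iInter]
    exact Set.definable_iInter_of_finite fun D => h₁ D (h𝒬 D.2)
  · ext v
    constructor
    · rintro ⟨w, hw⟩ _ ⟨𝒬, h𝒬, -, rfl⟩
      exact ⟨w, fun D hD => hw D (h𝒬 hD)⟩
    · intro hv
      obtain ⟨w, hw⟩ := hN.nonempty_iInter (mk_union_range_lt hκ hP v)
        (F := fun D : 𝒟 => {w : β → N | Sum.elim v w ∈ (D : Set (α ⊕ β → N))})
        (fun D => ((h₁ D D.2).isTypeDefinableOver).fiber v) (by
          intro t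
          obtain ⟨w, hw⟩ := hv _ ⟨Subtype.val '' (t : Set 𝒟), by rintro _ ⟨D, -, rfl⟩; exact D.2,
            t.finite_toSet.image _, rfl⟩
          exact ⟨w, Set.mem_iInter₂.2 fun D hD => hw D ⟨D, hD, rfl⟩⟩)
      exact ⟨w, fun D hD => Set.mem_iInter.1 hw ⟨D, hD⟩⟩

end TypeDefinable

/-! ### Subgroups of the extension and the splittings they induce. -/

section CocycleExtension

variable {G : Type uG} {A : Type uA} [Group G] [AddCommGroup A] [DistribMulAction G A]
  {h : TwoCocycle G A}

namespace CocycleExt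

/-- The projection of the extension onto `G`. -/
def sndHom (h : TwoCocycle G A) : CocycleExt h →* G where
  toFun := snd
  map_one' := rfl
  map_mul' _ _ := rfl

theorem sndHom_surjective : Function.Surjective (sndHom h) := fun g => ⟨⟨0, g⟩, rfl⟩

theorem mk_one_mul (a b : A) (g : G) :
    (⟨a, 1⟩ : CocycleExt h) * ⟨b, g⟩ = ⟨a + b, g⟩ := by
  rw [mul_def]
  simp [h.map_one_left']

theorem one_def : (1 : CocycleExt h) = ⟨0, 1⟩ := rfl

theorem mk_one_inv (a : A) : (⟨a, 1⟩ : CocycleExt h)⁻¹ = ⟨-a, 1⟩ := by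
  rw [inv_eq_iff_mul_eq_one, mk_one_mul, add_neg_cancel, one_def]

/-- Two lifts of `g` to `K` differ by an element of `K ∩ A`; all uniqueness of splitting functions
comes from here. -/
theorem sub_mk_one_mem {K : Subgroup (CocycleExt h)} {a b : A} {g : G}
    (ha : (⟨a, g⟩ : CocycleExt h) ∈ K) (hb : (⟨b, g⟩ : CocycleExt h) ∈ K) :
    (⟨a - b, 1⟩ : CocycleExt h) ∈ K := by
  have := mk_one_mul (h := h) (a - b) b g
  rw [sub_add_cancel] at this
  rw [eq_mul_inv_of_mul_eq this]
  exact K.mul_mem ha (K.inv_mem hb)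

/-- The elements `(a, g)` of the extension with `a ∈ S`. -/
def fstMem (S : AddSubgroup A) (hS : S.InvariantUnder G) (hhS : h.imageSubgroup ≤ S) :
    Subgroup (CocycleExt h) where
  carrier := {x | x.fst ∈ S}
  mul_mem' hx hy := S.add_mem (S.add_mem hx (hS _ _ hy)) (hhS (h.mem_imageSubgroup _ _))
  one_mem' := S.zero_mem
  inv_mem' hx := S.sub_mem (S.neg_mem (hS _ _ hx)) (hhS (h.mem_imageSubgroup _ _))

theorem mem_fstMem {S : AddSubgroup A} {hS : S.InvariantUnder G} {hhS : h.imageSubgroup ≤ S}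
    {x : CocycleExt h} : x ∈ fstMem S hS hhS ↔ x.fst ∈ S := Iff.rfl

/-- The subgroup `K ∩ A`. -/
def interKernel (K : Subgroup (CocycleExt h)) : AddSubgroup A where
  carrier := {a | (⟨a, 1⟩ : CocycleExt h) ∈ K}
  add_mem' ha hb := by
    have := K.mul_mem ha hb
    rwa [mk_one_mul] at this
  zero_mem' := K.one_mem
  neg_mem' ha := by
    have := K.inv_mem ha
    rwa [mk_one_inv] at this

theorem mem_interKernel {K : Subgroup (CocycleExt h)} {a : A} :
    a ∈ interKernel K ↔ (⟨a, 1⟩ : CocycleExt h) ∈ K := Iff.rfl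

/-- Conjugation by a lift of `g` to `K` acts on the kernel `A` as `g` does. The projection
hypothesis provides a lift of every `g`. -/
theorem interKernel_invariantUnder {K : Subgroup (CocycleExt h)}
    (hK : K.map (sndHom h) = ⊤) : (interKernel K).InvariantUnder G := by
  intro g a ha
  obtain ⟨⟨b, g'⟩, hx, hg⟩ : g ∈ K.map (sndHom h) := hK ▸ Subgroup.mem_top g
  obtain rfl : g' = g := hg
  have hy : (⟨b + g' • a, g'⟩ : CocycleExt h) ∈ K := by
    have := K.mul_mem hx ha
    rwa [mul_def, h.map_one_right', add_zero, mul_one] at this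
  have := sub_mk_one_mem hy hx
  rwa [add_sub_cancel_left] at this

end CocycleExt

theorem AddSubgroup.InvariantUnder.sup {S T : AddSubgroup A} (hS : S.InvariantUnder G)
    (hT : T.InvariantUnder G) : (S ⊔ T).InvariantUnder G := by
  intro g a ha
  obtain ⟨s, hs, t, ht, rfl⟩ := AddSubgroup.mem_sup.1 ha
  rw [smul_add]
  exact AddSubgroup.mem_sup.2 ⟨_, hS g s hs, _, hT g t ht, rfl⟩

theorem TwoCocycle.toCoeff_eq_iff {C : AddSubgroup A} {hC : C.InvariantUnder G}
    {a b : h.imageSubgroup} : h.toCoeff C hC a = h.toCoeff C hC b ↔ (a : A) - b ∈ C := by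
  rw [eq_comm]
  refine QuotientAddGroup.eq.trans ?_
  rw [AddSubgroup.mem_addSubgroupOf, AddSubgroup.coe_add, AddSubgroup.coe_neg, neg_add_eq_sub]

/-- A subgroup `K` of the extension which meets `A` inside `C` and contains, over each element of
`X`, an element with first coordinate in `C + A₀`, induces a splitting over `X` of the
induced 2-cocycle. -/
theorem TwoCocycle.exists_split_of_subgroup {K : Subgroup (CocycleExt h)} {C : AddSubgroup A}
    {hC : C.InvariantUnder G} {X : Subgroup G}
    (hX : ∀ g ∈ X, ∃ a ∈ C ⊔ h.imageSubgroup, (⟨a, g⟩ : CocycleExt h) ∈ K)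
    (hKC : CocycleExt.interKernel K ≤ C) :
    ∃ f : G → h.Coeff C hC,
      (∀ g ∈ X, ∀ a, f g = h.toCoeff C hC a ↔ ∃ c ∈ C, (⟨c - a, g⟩ : CocycleExt h) ∈ K) ∧
      f 1 = 0 ∧ ∀ g₁ ∈ X, ∀ g₂ ∈ X,
        h.induced C hC g₁ g₂ = f g₁ + g₁ • f g₂ - f (g₁ * g₂) := by
  classical
  -- The function is total on `G`, with value `0` off `X`, so that no subtype arithmetic is needed
  -- for `g₁ * g₂`.
  have hX' : ∀ g : G, ∃ a : h.imageSubgroup, g ∈ X → ∃ c ∈ C, (⟨c - a, g⟩ : CocycleExt h) ∈ K := by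
    intro g
    by_cases hg : g ∈ X
    · obtain ⟨_, hS, hK⟩ := hX g hg
      obtain ⟨c, hc, a, ha, rfl⟩ := AddSubgroup.mem_sup.1 hS
      -- The sign makes `g ↦ (-f g, g)` multiplicative modulo `C`, which matches the convention `h =
      -- f g₁ + g₁ • f g₂ - f (g₁ g₂)`.
      refine ⟨⟨-a, neg_mem ha⟩, fun _ => ⟨c, hc, ?_⟩⟩
      simpa using hK
    · exact ⟨0, fun h => (hg h).elim⟩
  choose r hr using hX'
  have char : ∀ g ∈ X, ∀ a, h.toCoeff C hC (r g) = h.toCoeff C hC a ↔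
      ∃ c ∈ C, (⟨c - a, g⟩ : CocycleExt h) ∈ K := by
    intro g hg a
    obtain ⟨c₀, hc₀, hK₀⟩ := hr g hg
    rw [toCoeff_eq_iff]
    constructor
    · intro ha
      refine ⟨c₀ - (r g - a), sub_mem hc₀ ha, ?_⟩
      convert hK₀ using 2
      abel
    · rintro ⟨c, hc, hK⟩
      have h₁ := hKC (CocycleExt.sub_mk_one_mem hK hK₀)
      have h₂ : (r g : A) - a = (c - a - (c₀ - r g)) - (c - c₀) := by abel
      rw [h₂]
      exact sub_mem h₁ (sub_mem hc hc₀)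
  refine ⟨fun g => h.toCoeff C hC (r g), char, ?_, ?_⟩
  · rw [← map_zero (h.toCoeff C hC)]
    refine (char 1 X.one_mem 0).2 ⟨0, C.zero_mem, ?_⟩
    rw [AddSubgroup.coe_zero, sub_zero, ← CocycleExt.one_def]
    exact K.one_mem
  · intro g₁ hg₁ g₂ hg₂
    obtain ⟨c₁, hc₁, hK₁⟩ := hr g₁ hg₁
    obtain ⟨c₂, hc₂, hK₂⟩ := hr g₂ hg₂
    -- The product of the chosen lifts of `g₁` and `g₂` is a lift of `g₁ * g₂`, and the
    -- characterisation reads off the value of `f` there.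
    have key := (char (g₁ * g₂) (X.mul_mem hg₁ hg₂) (r g₁ +
      ⟨g₁ • (r g₂ : A), h.imageSubgroup_invariant g₁ _ (r g₂).2⟩ -
      ⟨h g₁ g₂, h.mem_imageSubgroup g₁ g₂⟩)).2 ⟨c₁ + g₁ • c₂, add_mem hc₁ (hC _ _ hc₂), by
        convert K.mul_mem hK₁ hK₂ using 1
        rw [CocycleExt.mul_def]
        refine CocycleExt.ext ?_ rfl
        simp only [AddSubgroup.coe_sub, AddSubgroup.coe_add, smul_sub]
        abel⟩
    change h.toCoeff C hC _ = _
    simp only [key, map_sub, map_add, smul_toCoeff]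
    abel

end CocycleExtension

/-! ### Comparison of indices. -/

section Index

variable {G A : Type w'} [Group G] [AddCommGroup A] [DistribMulAction G A] {h : TwoCocycle G A}

namespace CocycleExt

/-- Every coset has a representative in the kernel: `(a, g) = (a, 1)(0, g)`, and `(0, g)` lies in
`fstMem S`. -/
theorem mk_quotient_fstMem_le {C S : AddSubgroup A} {hS : S.InvariantUnder G}
    {hhS : h.imageSubgroup ≤ S} (hCS : C ≤ S) : #(CocycleExt h ⧸ fstMem S hS hhS) ≤ #(A ⧸ C) := by
  let F : A ⧸ C → CocycleExt h ⧸ fstMem S hS hhS :=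
    Quotient.lift (fun a => ((⟨a, 1⟩ : CocycleExt h) : CocycleExt h ⧸ fstMem S hS hhS)) (by
      intro a b hab
      refine QuotientGroup.eq.2 ?_
      rw [mk_one_inv, mk_one_mul, mem_fstMem]
      exact hCS (QuotientAddGroup.leftRel_apply.1 hab))
  refine mk_le_of_surjective (f := F) fun q => ?_
  obtain ⟨⟨a, g⟩, rfl⟩ := QuotientGroup.mk_surjective q
  refine ⟨(a : A ⧸ C), QuotientGroup.eq.2 ?_⟩
  rw [mk_one_inv, mk_one_mul, mem_fstMem, neg_add_cancel]
  exact S.zero_mem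

theorem mk_quotient_interKernel_le (K : Subgroup (CocycleExt h)) :
    #(A ⧸ interKernel K) ≤ #(CocycleExt h ⧸ K) := by
  let F : A ⧸ interKernel K → CocycleExt h ⧸ K :=
    Quotient.lift (fun a => ((⟨a, 1⟩ : CocycleExt h) : CocycleExt h ⧸ K)) (by
      intro a b hab
      refine QuotientGroup.eq.2 ?_
      rw [mk_one_inv, mk_one_mul]
      exact QuotientAddGroup.leftRel_apply.1 hab)
  refine mk_le_of_injective (f := F) fun p q => ?_
  obtain ⟨a, rfl⟩ := QuotientAddGroup.mk_surjective p
  obtain ⟨b, rfl⟩ := QuotientAddGroup.mk_surjective q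
  intro hpq
  refine QuotientAddGroup.eq.2 ?_
  have := QuotientGroup.eq.1 hpq
  rwa [mk_one_inv, mk_one_mul] at this

theorem mk_quotient_map_sndHom_le (K : Subgroup (CocycleExt h)) :
    #(G ⧸ K.map (sndHom h)) ≤ #(CocycleExt h ⧸ K) := by
  let F : CocycleExt h ⧸ K → G ⧸ K.map (sndHom h) :=
    Quotient.lift (fun x => (sndHom h x : G ⧸ K.map (sndHom h))) (by
      intro x y hxy
      refine QuotientGroup.eq.2 ?_
      rw [← map_inv, ← map_mul]
      exact Subgroup.mem_map_of_mem _ (QuotientGroup.leftRel_apply.1 hxy))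
  refine mk_le_of_surjective (f := F) fun q => ?_
  obtain ⟨g, rfl⟩ := QuotientGroup.mk_surjective q
  obtain ⟨x, rfl⟩ := sndHom_surjective (h := h) g
  exact ⟨x, rfl⟩

end CocycleExt

theorem Subgroup.mk_quotient_inf_le {X : Type w'} [Group X] (H K : Subgroup X) :
    #(X ⧸ (H ⊓ K : Subgroup X)) ≤ #(X ⧸ H) * #(X ⧸ K) := by
  let F : X ⧸ (H ⊓ K : Subgroup X) → (X ⧸ H) × (X ⧸ K) := fun q =>
    (Subgroup.quotientMapOfLE inf_le_left q, Subgroup.quotientMapOfLE inf_le_right q)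
  rw [mul_def]
  refine mk_le_of_injective (f := F) fun p q => ?_
  obtain ⟨x, rfl⟩ := QuotientGroup.mk_surjective p
  obtain ⟨y, rfl⟩ := QuotientGroup.mk_surjective q
  intro hxy
  exact QuotientGroup.eq.2 ⟨QuotientGroup.eq.1 (congrArg Prod.fst hxy),
    QuotientGroup.eq.1 (congrArg Prod.snd hxy)⟩

end Index

/-! ### Automorphisms of the monster model and invariance over `B`. -/

section Automorphisms

variable {L : FirstOrder.Language.{u, v}} {M : Type w} {N : Type w'}
variable [L.Structure M] [L.Structure N]

/-- The sentence saying that the formula over `B` has `x` as its only solution transfers to `N`; an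
automorphism over `B` preserves that formula, so it fixes `j x`. -/
theorem apply_eq_of_mem_definableClosure {B : Set M} (j : M ↪ₑ[L] N) {σ : N ≃[L] N}
    (hσ : ∀ b ∈ j '' B, σ b = b) {x : M} (hx : x ∈ definableClosure L B) : σ (j x) = j x := by
  obtain ⟨φ, hφ⟩ := Set.definable_iff_exists_formula_sum.1 hx
  have hφ' : ∀ v : Fin 1 → M, φ.Realize (Sum.elim (fun b : B => (b : M)) v) ↔ v 0 = x :=
    fun v => (Set.ext_iff.1 hφ v).symm
  have hS : SameFormula j (fun v : Fin 1 → M => φ.Realize (Sum.elim (fun b : B => (b : M)) v) ↔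
      v 0 = x) (fun v => φ.Realize (Sum.elim (fun b : B => j b) v) ↔ v 0 = j x) := by
    refine ⟨(φ.relabel (Sum.map Subtype.val id)).iff
      ((FirstOrder.Language.Term.var (Sum.inr 0)).equal
        (FirstOrder.Language.Term.var (Sum.inl x))), fun v => ?_, fun v => ?_⟩ <;>
    · rw [FirstOrder.Language.Formula.realize_iff, FirstOrder.Language.Formula.realize_relabel,
        FirstOrder.Language.Formula.realize_equal]
      refine iff_of_eq (congrArg₂ _ (congrArg _ ?_) rfl)
      funext i
      rcases i with i | i <;> rfl
  have T := hS.transfer hφ'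
  refine (T fun _ => σ (j x)).1 ?_
  have h₁ := (T fun _ => j x).2 rfl
  rw [← FirstOrder.Language.StrongHomClass.realize_formula σ] at h₁
  convert h₁ using 1
  funext i
  rcases i with i | i
  · exact (hσ _ ⟨i, i.2, rfl⟩).symm
  · rfl

namespace DefinableCocycle

variable {G : Type uG} {A : Type uA} [Group G] [AddCommGroup A] [DistribMulAction G A]
variable {B : Set M} {h : TwoCocycle G A} (D : DefinableCocycle L B h) (j : M ↪ₑ[L] N)
  (σ : N ≃[L] N) {P : Set N}

/-- The action of an automorphism of `N` on `G*`. -/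
def autG (x : D.GStar j) : D.GStar j :=
  ⟨σ ∘ x.1, (FirstOrder.Language.StrongHomClass.realize_formula σ _).2 x.2⟩

/-- The action of an automorphism of `N` on `A*`. -/
noncomputable def autA : D.AStar j →+ D.AStar j :=
  AddMonoidHom.mk'
    (fun x => ⟨σ ∘ x.1, (FirstOrder.Language.StrongHomClass.realize_formula σ _).2 x.2⟩)
    (fun x y => by
      refine ((D.addRel_iff j).1 ?_).symm
      have := (FirstOrder.Language.StrongHomClass.realize_formula σ _).2
        ((D.addRel_iff j).2 (rfl : x + y = x + y))
      rwa [tri_comp] at this)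

theorem isInvariantOver_image_coordGStar {S : Set (D.GStar j)} :
    IsInvariantOver L P (D.coordGStar j '' S) ↔
      ∀ σ : N ≃[L] N, (∀ b ∈ P, σ b = b) → ∀ x ∈ S, D.autG j σ x ∈ S := by
  refine forall₂_congr fun σ _ => ?_
  rw [Set.forall_mem_image]
  refine forall₂_congr fun x _ => ?_
  exact Function.Injective.mem_set_image (f := D.coordGStar j) (a := D.autG j σ x)
    Subtype.val_injective

theorem isInvariantOver_image_coordAStar {S : Set (D.AStar j)} :
    IsInvariantOver L P (D.coordAStar j '' S) ↔
      ∀ σ : N ≃[L] N, (∀ b ∈ P, σ b = b) → ∀ x ∈ S, D.autA j σ x ∈ S := by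
  refine forall₂_congr fun σ _ => ?_
  rw [Set.forall_mem_image]
  refine forall₂_congr fun x _ => ?_
  exact Function.Injective.mem_set_image (f := D.coordAStar j) (a := D.autA j σ x)
    Subtype.val_injective

theorem coordExt_injective : Function.Injective (D.coordExt j) := fun _ _ hxy =>
  CocycleExt.ext (Subtype.ext (funext fun i => congrFun hxy (Sum.inl i)))
    (Subtype.ext (funext fun i => congrFun hxy (Sum.inr i)))

theorem isInvariantOver_image_coordExt {S : Set (CocycleExt (D.hStar j))} :
    IsInvariantOver L P (D.coordExt j '' S) ↔
      ∀ σ : N ≃[L] N, (∀ b ∈ P, σ b = b) → ∀ x ∈ S, ⟨D.autA j σ x.fst, D.autG j σ x.snd⟩ ∈ S := by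
  refine forall₂_congr fun σ _ => ?_
  rw [Set.forall_mem_image]
  refine forall₂_congr fun x _ => ?_
  rw [← (D.coordExt_injective j).mem_set_image]
  refine iff_of_eq (congrArg (· ∈ _) ?_)
  funext i
  rcases i with i | i <;> rfl

variable {j σ}

/-- Finiteness of the image ensures that `h*` takes no new values in `N`, so the generators of `A₀`
still have coordinates in the definable closure of `B`. -/
theorem autA_apply_of_mem_imageSubgroup (hfin : h.image.Finite)
    (hdcl : ∀ a ∈ h.image, ∀ i, D.coordA a i ∈ definableClosure L B)
    (hσ : ∀ b ∈ j '' B, σ b = b) {a : D.AStar j} (ha : a ∈ (D.hStar j).imageSubgroup) :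
    D.autA j σ a = a := by
  refine AddMonoidHom.eqOn_closure (f := D.autA j σ) (g := AddMonoidHom.id _) ?_ ha
  intro z hz
  rw [D.image_hStar j hfin] at hz
  obtain ⟨a, ha, rfl⟩ := hz
  exact Subtype.ext (funext fun i => apply_eq_of_mem_definableClosure j hσ (hdcl a ha i))

theorem isInvariantOver_sup_imageSubgroup (hfin : h.image.Finite)
    (hdcl : ∀ a ∈ h.image, ∀ i, D.coordA a i ∈ definableClosure L B) {C : AddSubgroup (D.AStar j)}
    (hC : IsInvariantOver L (j '' B) (D.coordAStar j '' C)) :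
    IsInvariantOver L (j '' B)
      (D.coordAStar j '' (C ⊔ (D.hStar j).imageSubgroup : AddSubgroup (D.AStar j))) := by
  rw [isInvariantOver_image_coordAStar] at hC ⊢
  intro σ hσ x hx
  obtain ⟨c, hc, a, ha, rfl⟩ := AddSubgroup.mem_sup.1 hx
  rw [map_add, D.autA_apply_of_mem_imageSubgroup hfin hdcl hσ ha]
  exact AddSubgroup.mem_sup.2 ⟨_, hC σ hσ c hc, a, ha, rfl⟩

theorem isInvariantOver_fstMem {S : AddSubgroup (D.AStar j)} {hS : S.InvariantUnder (D.GStar j)}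
    {hhS : (D.hStar j).imageSubgroup ≤ S} (hSP : IsInvariantOver L P (D.coordAStar j '' S)) :
    IsInvariantOver L P (D.coordExt j '' (CocycleExt.fstMem S hS hhS)) := by
  rw [isInvariantOver_image_coordAStar] at hSP
  rw [isInvariantOver_image_coordExt]
  exact fun σ hσ x hx => hSP σ hσ _ hx

theorem isInvariantOver_map_sndHom {K : Subgroup (CocycleExt (D.hStar j))}
    (hK : IsInvariantOver L P (D.coordExt j '' K)) :
    IsInvariantOver L P (D.coordGStar j '' (K.map (CocycleExt.sndHom _))) := by
  rw [isInvariantOver_image_coordExt] at hK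
  rw [isInvariantOver_image_coordGStar]
  rintro σ hσ _ ⟨x, hx, rfl⟩
  exact ⟨_, hK σ hσ x hx, rfl⟩

/-- The splitting function given by an invariant subgroup of the extension is invariant. -/
theorem exists_invariant_split_of_subgroup (hfin : h.image.Finite)
    (hdcl : ∀ a ∈ h.image, ∀ i, D.coordA a i ∈ definableClosure L B)
    {K : Subgroup (CocycleExt (D.hStar j))}
    (hK : IsInvariantOver L (j '' B) (D.coordExt j '' K))
    {C : AddSubgroup (D.AStar j)} (hC : C.InvariantUnder (D.GStar j))
    (hCB : IsInvariantOver L (j '' B) (D.coordAStar j '' C))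
    {X : Subgroup (D.GStar j)} (hXB : IsInvariantOver L (j '' B) (D.coordGStar j '' X))
    (hX : ∀ g ∈ X, ∃ a ∈ C ⊔ (D.hStar j).imageSubgroup, ⟨a, g⟩ ∈ K)
    (hKC : CocycleExt.interKernel K ≤ C) :
    ∃ f : D.GStar j → (D.hStar j).Coeff C hC,
      IsInvariantFunOver L (j '' B) (fun g : X => D.coordGStar j (g : D.GStar j))
        (D.coordAStar j) (fun g : X => f g) ∧
      f 1 = 0 ∧ ∀ g₁ ∈ X, ∀ g₂ ∈ X,
        (D.hStar j).induced C hC g₁ g₂ = f g₁ + g₁ • f g₂ - f (g₁ * g₂) := by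
  obtain ⟨f, hf, hf₁, hf₂⟩ := TwoCocycle.exists_split_of_subgroup (hC := hC) hX hKC
  refine ⟨f, ?_, hf₁, hf₂⟩
  rw [isInvariantOver_image_coordExt] at hK
  rw [isInvariantOver_image_coordGStar] at hXB
  rw [isInvariantOver_image_coordAStar] at hCB
  rintro σ hσ _ ⟨⟨x, hx⟩, a, hfa, rfl⟩
  obtain ⟨c, hc, hcK⟩ := (hf x hx a).1 hfa
  -- The value `a` stays put because `σ` fixes `A₀` pointwise; only the correcting element `c ∈ C`
  -- moves, and it stays in `C`.
  refine ⟨⟨D.autG j σ x, hXB σ hσ x hx⟩, a, (hf _ (hXB σ hσ x hx) a).2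
    ⟨D.autA j σ c, hCB σ hσ c hc, ?_⟩, ?_⟩
  · have := hK σ hσ _ hcK
    rwa [map_sub, D.autA_apply_of_mem_imageSubgroup hfin hdcl hσ a.2] at this
  · conv_rhs => rw [← D.autA_apply_of_mem_imageSubgroup hfin hdcl hσ a.2]
    funext i
    rcases i with i | i <;> rfl

end DefinableCocycle

end Automorphisms

/-! ### Infinite divisibility in finitely generated torsion-free groups. -/

/-- Such a group is free, and an integer coordinate divisible by a power of `p` exceeding its
absolute value is zero. -/
theorem eq_zero_of_forall_exists_pow_nsmul {Z : Type*} [AddCommGroup Z] [Module.Finite ℤ Z]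
    [IsAddTorsionFree Z] {p : ℕ} (hp : 1 < p) {x : Z} (hx : ∀ n : ℕ, ∃ y, x = p ^ n • y) :
    x = 0 := by
  have : Module.Free ℤ Z := inferInstance
  let b := Module.Free.chooseBasis ℤ Z
  refine b.ext_elem fun i => ?_
  rw [map_zero, Finsupp.zero_apply]
  obtain ⟨n, hn⟩ := pow_unbounded_of_one_lt (b.repr x i).natAbs hp
  obtain ⟨y, hy⟩ := hx n
  refine Int.natAbs_eq_zero.1 (Nat.eq_zero_of_dvd_of_lt ?_ hn)
  rw [hy, map_nsmul, Finsupp.smul_apply, nsmul_eq_mul, Int.natAbs_mul]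
  rw [Int.natAbs_natCast]
  exact Nat.dvd_mul_right _ _

namespace TwoCocycle

variable {G : Type uG} {A : Type uA} [Group G] [AddCommGroup A] [DistribMulAction G A]
  {h : TwoCocycle G A} {C : AddSubgroup A} {hC : C.InvariantUnder G}

theorem finite_coeff (hfin : h.image.Finite) : Module.Finite ℤ (h.Coeff C hC) := by
  rw [Module.Finite.iff_addGroup_fg]
  have : AddGroup.FG h.imageSubgroup := by
    rw [AddGroup.fg_iff_addSubgroup_fg, AddSubgroup.fg_iff]
    exact ⟨_, rfl, hfin⟩
  exact AddGroup.fg_of_surjective (h.toCoeff_surjective C hC)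

/-- The same fact read through `(C + A₀)/C ≅ A₀/(C ∩ A₀)`, phrased inside `A` so that type-definable
subgroups can be fed to it. -/
theorem mem_of_forall_exists_sub_pow_nsmul_mem (hfin : h.image.Finite)
    (htf : IsAddTorsionFree (h.Coeff C hC)) {p : ℕ} (hp : 1 < p) {x : A}
    (hxS : x ∈ C ⊔ h.imageSubgroup)
    (hx : ∀ n : ℕ, ∃ y ∈ C ⊔ h.imageSubgroup, x - p ^ n • y ∈ C) : x ∈ C := by
  have := finite_coeff (hC := hC) hfin
  obtain ⟨c, hc, a, ha, rfl⟩ := AddSubgroup.mem_sup.1 hxS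
  have key : h.toCoeff C hC ⟨a, ha⟩ = 0 := by
    refine eq_zero_of_forall_exists_pow_nsmul hp fun n => ?_
    obtain ⟨y, hy, hxy⟩ := hx n
    obtain ⟨c', hc', a', ha', rfl⟩ := AddSubgroup.mem_sup.1 hy
    refine ⟨h.toCoeff C hC ⟨a', ha'⟩, ?_⟩
    rw [← map_nsmul, toCoeff_eq_iff]
    have h₁ : a - p ^ n • a' = c + a - p ^ n • (c' + a') - c + p ^ n • c' := by
      rw [smul_add]; abel
    change a - p ^ n • a' ∈ C
    rw [h₁]
    exact add_mem (sub_mem hxy hc) (nsmul_mem hc' _)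
  rw [← map_zero (h.toCoeff C hC), toCoeff_eq_iff] at key
  exact add_mem hc (by simpa using key)

end TwoCocycle

/-! ### Type-definable subgroups of `A*` and the compactness argument. -/

namespace DefinableCocycle

variable {L : FirstOrder.Language.{u, v}} {M : Type w} {N : Type w'}
variable [L.Structure M] [L.Structure N]
variable {G : Type uG} {A : Type uA} [Group G] [AddCommGroup A] [DistribMulAction G A]
variable {B : Set M} {h : TwoCocycle G A} (D : DefinableCocycle L B h) {j : M ↪ₑ[L] N}
  {P : Set N} {κ : Cardinal.{w'}}

theorem isTypeDefinableOver_singleton {a : D.AStar j} (ha : Set.range (D.coordAStar j a) ⊆ P) :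
    IsTypeDefinableOver L P (D.coordAStar j '' {a}) := by
  have : D.coordAStar j '' {a} = ⋂ i, {v | v ∘ (fun _ : Fin 1 => i) ∈
      {x : Fin 1 → N | x 0 ∈ ({D.coordAStar j a i} : Set N)}} := by
    ext v
    simp [funext_iff]
  rw [this]
  exact IsTypeDefinableOver.iInter fun i => IsTypeDefinableOver.preimage_comp _
    (Set.Definable.singleton_of_mem L (ha ⟨i, rfl⟩)).isTypeDefinableOver

theorem isTypeDefinableOver_image2_add (hN : IsSaturatedModel L N κ) (hκ : ℵ₀ < κ) (hP : #P < κ)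
    {S T : Set (D.AStar j)} (hS : IsTypeDefinableOver L P (D.coordAStar j '' S))
    (hT : IsTypeDefinableOver L P (D.coordAStar j '' T)) :
    IsTypeDefinableOver L P (D.coordAStar j '' (Set.image2 (· + ·) S T)) := by
  let e : Fin D.m ⊕ Fin D.m ⊕ Fin D.m → Fin D.m ⊕ (Fin D.m ⊕ Fin D.m) :=
    Sum.elim (Sum.inr ∘ Sum.inl) (Sum.elim (Sum.inr ∘ Sum.inr) Sum.inl)
  have he : ∀ x y z : Fin D.m → N, Sum.elim z (Sum.elim x y) ∘ e = tri x y z := by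
    intro x y z
    funext i
    rcases i with i | i | i <;> rfl
  convert ((hS.preimage_comp (Sum.inr ∘ Sum.inl)).inter
    ((hT.preimage_comp (Sum.inr ∘ Sum.inr)).inter
    (((Set.Definable.realize_formula D.addA).isTypeDefinableOver (P := P)).preimage_comp
      e))).inter (((Set.Definable.realize_formula D.domA).isTypeDefinableOver (P := P)).preimage_comp
      Sum.inl) |>.exists_block hN hκ hP using 1
  ext z
  constructor
  · rintro ⟨_, ⟨x, hx, y, hy, rfl⟩, rfl⟩
    refine ⟨Sum.elim x.1 y.1, ⟨⟨x, hx, rfl⟩, ⟨y, hy, rfl⟩, ?_⟩, (x + y).2⟩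
    change D.addA.Realize (_ ∘ e)
    rw [he]
    exact (D.addRel_iff j).2 rfl
  · rintro ⟨w, ⟨⟨x, hx, hx'⟩, ⟨y, hy, hy'⟩, hw⟩, hz⟩
    have hw' : w = Sum.elim x.1 y.1 := by
      funext i
      rcases i with i | i
      · exact (congrFun hx' i).symm
      · exact (congrFun hy' i).symm
    subst hw'
    change D.addA.Realize (_ ∘ e) at hw
    rw [he] at hw
    have : x + y = ⟨z, hz⟩ := (D.addRel_iff j).1 hw
    exact ⟨_, ⟨x, hx, y, hy, rfl⟩, congrArg Subtype.val this⟩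

theorem isTypeDefinableOver_image_add_self (hN : IsSaturatedModel L N κ) (hκ : ℵ₀ < κ)
    (hP : #P < κ) {S : Set (D.AStar j)} (hS : IsTypeDefinableOver L P (D.coordAStar j '' S)) :
    IsTypeDefinableOver L P (D.coordAStar j '' ((fun x => x + x) '' S)) := by
  let e : Fin D.m ⊕ Fin D.m ⊕ Fin D.m → Fin D.m ⊕ Fin D.m :=
    Sum.elim Sum.inr (Sum.elim Sum.inr Sum.inl)
  have he : ∀ x z : Fin D.m → N, Sum.elim z x ∘ e = tri x x z := by
    intro x z
    funext i
    rcases i with i | i | i <;> rfl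
  convert ((hS.preimage_comp Sum.inr).inter
    (((Set.Definable.realize_formula D.addA).isTypeDefinableOver (P := P)).preimage_comp
      e)).inter (((Set.Definable.realize_formula D.domA).isTypeDefinableOver (P := P)).preimage_comp
      Sum.inl) |>.exists_block hN hκ hP using 1
  ext z
  constructor
  · rintro ⟨_, ⟨x, hx, rfl⟩, rfl⟩
    refine ⟨x.1, ⟨⟨x, hx, rfl⟩, ?_⟩, (x + x).2⟩
    change D.addA.Realize (_ ∘ e)
    rw [he]
    exact (D.addRel_iff j).2 rfl
  · rintro ⟨w, ⟨⟨x, hx, hx'⟩, hw⟩, hz⟩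
    obtain rfl : x.1 = w := hx'
    change D.addA.Realize (_ ∘ e) at hw
    rw [he] at hw
    have : x + x = ⟨z, hz⟩ := (D.addRel_iff j).1 hw
    exact ⟨_, ⟨x, hx, rfl⟩, congrArg Subtype.val this⟩

/-- Iterated doubling suffices, since the multiples that occur below are by powers of 4. -/
theorem isTypeDefinableOver_image_two_pow_nsmul (hN : IsSaturatedModel L N κ) (hκ : ℵ₀ < κ)
    (hP : #P < κ) {S : Set (D.AStar j)} (hS : IsTypeDefinableOver L P (D.coordAStar j '' S))
    (n : ℕ) : IsTypeDefinableOver L P (D.coordAStar j '' ((fun x => 2 ^ n • x) '' S)) := by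
  induction n with
  | zero => simpa using hS
  | succ n ih =>
    convert D.isTypeDefinableOver_image_add_self hN hκ hP ih using 2
    rw [Set.image_image]
    refine Set.image_congr fun x _ => ?_
    rw [pow_succ, mul_two, add_smul]

/-- The identity of `G*` is cut out without parameters as the solution of `g * g = g`, so no point
beyond `P` is needed. -/
theorem isTypeDefinableOver_interKernel (hN : IsSaturatedModel L N κ) (hκ : ℵ₀ < κ)
    (hP : #P < κ) {K : Subgroup (CocycleExt (D.hStar j))}
    (hK : IsTypeDefinableOver L P (D.coordExt j '' K)) :
    IsTypeDefinableOver L P (D.coordAStar j '' (CocycleExt.interKernel K)) := by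
  convert (hK.inter (((Set.Definable.realize_formula D.mulG).isTypeDefinableOver
    (P := P)).preimage_comp (Sum.elim Sum.inr (Sum.elim Sum.inr Sum.inr)))).exists_block
      hN hκ hP using 1
  have he : ∀ (a : Fin D.m → N) (g : Fin D.n → N), Sum.elim a g ∘ Sum.elim Sum.inr
      (Sum.elim Sum.inr Sum.inr) = tri g g g := by
    intro a g
    funext i
    rcases i with i | i | i <;> rfl
  ext z
  constructor
  · rintro ⟨a, ha, rfl⟩
    refine ⟨(1 : D.GStar j).1, ⟨_, ha, rfl⟩, ?_⟩
    change D.mulG.Realize (_ ∘ _)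
    rw [he]
    exact D.mulRel_one_one j
  · rintro ⟨w, ⟨⟨a, g⟩, hx, hx'⟩, hw⟩
    obtain rfl : a.1 = z := funext fun i => congrFun hx' (Sum.inl i)
    obtain rfl : g.1 = w := funext fun i => congrFun hx' (Sum.inr i)
    change D.mulG.Realize (_ ∘ _) at hw
    rw [he] at hw
    obtain rfl : g = 1 := mul_eq_left.1 ((D.mulRel_iff j).1 hw)
    exact ⟨a, hx, rfl⟩

theorem isTypeDefinableOver_map_sndHom (hN : IsSaturatedModel L N κ) (hκ : ℵ₀ < κ)
    (hP : #P < κ) {K : Subgroup (CocycleExt (D.hStar j))}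
    (hK : IsTypeDefinableOver L P (D.coordExt j '' K)) :
    IsTypeDefinableOver L P (D.coordGStar j '' (K.map (CocycleExt.sndHom _))) := by
  convert (hK.preimage_comp Sum.swap).exists_block hN hκ hP using 1
  ext z
  constructor
  · rintro ⟨_, ⟨x, hx, rfl⟩, rfl⟩
    refine ⟨x.fst.1, x, hx, ?_⟩
    funext i
    rcases i with i | i <;> rfl
  · rintro ⟨w, x, hx, hx'⟩
    exact ⟨_, ⟨x, hx, rfl⟩, funext fun i => congrFun hx' (Sum.inr i)⟩

/-- In the compact group `(H + C) / C`, the sums `(1 + 4 + ⋯ + 4 ^ (n - 1)) • a` accumulate at a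
solution of the equation `3 • x + a = 0` modulo all multiples of powers of `4`. -/
theorem exists_three_nsmul_add_sub_four_pow_nsmul_mem (hN : IsSaturatedModel L N κ) (hκ : ℵ₀ < κ)
    (hP : #P < κ) {H C : AddSubgroup (D.AStar j)}
    (hH : IsTypeDefinableOver L P (D.coordAStar j '' H))
    (hC : IsTypeDefinableOver L P (D.coordAStar j '' C)) {a : D.AStar j} (ha : a ∈ H) :
    ∃ x ∈ H, ∀ n : ℕ, ∃ y ∈ H, 3 • x + a - 4 ^ n • y ∈ C := by
  -- Coordinates of all multiples of `a` become parameters; there are only countably many, so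
  -- saturation still applies.
  let r : ℕ × Fin D.m → N := fun i => D.coordAStar j (i.1 • a) i.2
  have hQ := mk_union_range_lt hκ hP r
  have hPQ : P ⊆ P ∪ Set.range r := Set.subset_union_left
  let m : ℕ → ℕ := fun n => ∑ k ∈ Finset.range n, 4 ^ k
  have hm_succ : ∀ n, m (n + 1) = m n + 4 ^ n := fun n => Finset.sum_range_succ _ _
  -- The geometric sum is `m n = (4^n - 1)/3`. Base 2 would be useless: the factor 3 would become 1,
  -- and the limit would just be `-a`.
  have hm : ∀ n, 3 * m n + 1 = 4 ^ n := by
    intro n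
    induction n with
    | zero => simp [m]
    | succ n ih => rw [hm_succ, pow_succ]; omega
  -- The cosets `m n • a + 4^n H + C`, whose common points play the role of the limit.
  let T : ℕ → Set (D.AStar j) := fun n => Set.image2 (· + ·)
    (Set.image2 (· + ·) {m n • a} ((fun x => 4 ^ n • x) '' H)) C
  have hT : ∀ n, IsTypeDefinableOver L (P ∪ Set.range r) (D.coordAStar j '' T n) := by
    intro n
    refine D.isTypeDefinableOver_image2_add hN hκ hQ (D.isTypeDefinableOver_image2_add hN hκ hQ
      (D.isTypeDefinableOver_singleton ?_) ?_) (hC.mono hPQ)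
    · rintro _ ⟨i, rfl⟩
      exact Or.inr ⟨(m n, i), rfl⟩
    · have := D.isTypeDefinableOver_image_two_pow_nsmul hN hκ hQ (hH.mono hPQ) (2 * n)
      rwa [pow_mul] at this
  have hanti : Antitone T := by
    refine antitone_nat_of_succ_le fun n => ?_
    rintro _ ⟨_, ⟨_, rfl, _, ⟨y, hy, rfl⟩, rfl⟩, c, hc, rfl⟩
    -- Nestedness: `m (n+1) • a + 4^(n+1) • y = m n • a + 4^n • (a + 4 • y)`.
    refine ⟨_, ⟨_, rfl, _, ⟨a + 4 • y, add_mem ha (nsmul_mem hy 4), rfl⟩, rfl⟩, c, hc, ?_⟩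
    simp only [hm_succ, add_smul, pow_succ, mul_smul, smul_add]
    abel
  obtain ⟨z, hz⟩ := hN.nonempty_iInter_of_directed hQ hT
    (fun n => ⟨_, _, ⟨_, ⟨_, rfl, _, ⟨0, H.zero_mem, rfl⟩, rfl⟩, 0, C.zero_mem, rfl⟩, rfl⟩)
    (directed_of_isDirected_le fun p q hpq => Set.image_mono (hanti hpq))
  rw [Set.mem_iInter] at hz
  -- Since `m 0 = 0`, stage `0` places the limit in `H + C`; `x` is its part in `H`.
  obtain ⟨x', ⟨_, ⟨_, rfl, _, ⟨x, hx, rfl⟩, rfl⟩, c₀, hc₀, rfl⟩, rfl⟩ := hz 0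
  refine ⟨x, hx, fun n => ?_⟩
  obtain ⟨x', ⟨_, ⟨_, rfl, _, ⟨y, hy, rfl⟩, rfl⟩, c, hc, rfl⟩, hxz⟩ := hz n
  have key : m n • a + 4 ^ n • y + c = x + c₀ := by
    refine Subtype.val_injective (hxz.trans ?_)
    simp [m, coordAStar]
  -- Modulo `C`, `3 • x + a = (3 m n + 1) • a + 3 • 4^n • y = 4^n • (a + 3 • y)`.
  refine ⟨a + 3 • y, add_mem ha (nsmul_mem hy 3), ?_⟩
  have : 3 • x + a - 4 ^ n • (a + 3 • y) = 3 • c - 3 • c₀ := by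
    rw [eq_sub_of_add_eq key.symm, ← hm n]
    module
  rw [this]
  exact sub_mem (nsmul_mem hc 3) (nsmul_mem hc₀ 3)

/-- A type-definable subgroup of `C + A₀`, with `C` type-definable and `A₀ / (C ∩ A₀)` torsion
free, is contained in `C`. -/
theorem le_of_le_sup_imageSubgroup (hN : IsSaturatedModel L N κ) (hκ : ℵ₀ < κ)
    (hP : #P < κ) (hfin : h.image.Finite) {H C : AddSubgroup (D.AStar j)}
    {hCG : C.InvariantUnder (D.GStar j)}
    (hH : IsTypeDefinableOver L P (D.coordAStar j '' H))
    (hC : IsTypeDefinableOver L P (D.coordAStar j '' C))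
    (htf : IsAddTorsionFree ((D.hStar j).Coeff C hCG))
    (hHC : H ≤ C ⊔ (D.hStar j).imageSubgroup) : H ≤ C := by
  have hfin' : (D.hStar j).image.Finite := by
    rw [D.image_hStar j hfin]
    exact hfin.image _
  -- `3 • x + a` is divisible by every `4^n` modulo `C`, hence lies in `C`; so `-x` is a third of
  -- `a`, and it is again in `H`.
  have h₃ : ∀ a ∈ H, ∃ y ∈ H, a - 3 • y ∈ C := by
    intro a ha
    obtain ⟨x, hx, hxy⟩ := D.exists_three_nsmul_add_sub_four_pow_nsmul_mem hN hκ hP hH hC ha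
    refine ⟨-x, neg_mem hx, ?_⟩
    have := TwoCocycle.mem_of_forall_exists_sub_pow_nsmul_mem hfin' htf (p := 4) (by norm_num)
      (hHC (add_mem (nsmul_mem hx 3) ha)) (fun n => by
        obtain ⟨y, hy, hy'⟩ := hxy n
        exact ⟨y, hHC hy, hy'⟩)
    rwa [smul_neg, sub_neg_eq_add, add_comm]
  intro a ha
  refine TwoCocycle.mem_of_forall_exists_sub_pow_nsmul_mem hfin' htf (p := 3) (by norm_num)
    (hHC ha) fun n => ?_
  -- Keeping the quotient in `H`, not merely in `C + A₀`, lets the division by 3 be iterated.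
  suffices ∃ y ∈ H, a - 3 ^ n • y ∈ C by
    obtain ⟨y, hy, hy'⟩ := this
    exact ⟨y, hHC hy, hy'⟩
  induction n with
  | zero => exact ⟨a, ha, by simp⟩
  | succ n ih =>
    obtain ⟨y, hy, hy'⟩ := ih
    obtain ⟨z, hz, hz'⟩ := h₃ y hy
    refine ⟨z, hz, ?_⟩
    have : a - 3 ^ (n + 1) • z = (a - 3 ^ n • y) + 3 ^ n • (y - 3 • z) := by
      rw [pow_succ]
      module
    rw [this]
    exact add_mem hy' (nsmul_mem hz' _)

end DefinableCocycle

/-! ### The connected components and their projections. -/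

section Components

variable {L : FirstOrder.Language.{u, v}} {N : Type w'} [L.Structure N] {P : Set N}
  {κ : Cardinal.{w'}} {X : Type w'} [Group X] {ι : Type x} {c : X → ι → N}

theorem isTypeDefinableOver_component00 (hc : Function.Injective c)
    (htop : IsTypeDefinableOver L P (Set.range c)) (hκ : 1 < κ) :
    IsTypeDefinableOver L P (c '' component00 L κ P c) := by
  -- The image under `c` commutes only with nonempty intersections; the whole group witnesses
  -- nonemptiness.
  have hne : Nonempty {H : Subgroup X | IsTypeDefinableOver L P (c '' H) ∧ #(X ⧸ H) < κ} := by
    refine ⟨⊤, ?_, ?_⟩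
    · rwa [Subgroup.coe_top, Set.image_univ]
    · exact (le_one_iff_subsingleton.2 QuotientGroup.subsingleton_quotient_top).trans_lt hκ
  rw [component00, Subgroup.coe_sInf, Set.biInter_eq_iInter, hc.injOn.image_iInter_eq]
  exact IsTypeDefinableOver.iInter fun H => H.2.1

end Components

namespace DefinableCocycle

variable {L : FirstOrder.Language.{u, v}} {M : Type w} {N : Type w'}
variable [L.Structure M] [L.Structure N]
variable {G : Type uG} {A : Type uA} [Group G] [AddCommGroup A] [DistribMulAction G A]
variable {B : Set M} {h : TwoCocycle G A} (D : DefinableCocycle L B h) {j : M ↪ₑ[L] N}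
  {P : Set N} {κ : Cardinal.{w'}}

theorem isTypeDefinableOver_range_coordExt :
    IsTypeDefinableOver L P (Set.range (D.coordExt j)) := by
  convert (((Set.Definable.realize_formula D.domA).isTypeDefinableOver (P := P)).preimage_comp
      (Sum.inl : _ → Fin D.m ⊕ Fin D.n)).inter
      (((Set.Definable.realize_formula D.domG).isTypeDefinableOver (P := P)).preimage_comp
      Sum.inr) using 1
  ext v
  constructor
  · rintro ⟨x, rfl⟩
    exact ⟨x.fst.2, x.snd.2⟩
  · rintro ⟨h₁, h₂⟩
    exact ⟨⟨⟨_, h₁⟩, ⟨_, h₂⟩⟩, Sum.elim_comp_inl_inr v⟩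

theorem isInvariantOver_component00_coordGStar :
    IsInvariantOver L P (D.coordGStar j '' component00 L κ P (D.coordGStar j)) := by
  rw [isInvariantOver_image_coordGStar]
  intro σ hσ x hx
  refine Subgroup.mem_sInf.2 fun H hH => ?_
  exact (D.isInvariantOver_image_coordGStar j).1 hH.1.isInvariantOver σ hσ x
    (Subgroup.mem_sInf.1 hx H hH)

/-- The component `X^{00}` of the extension projects onto that of `G*`. -/
theorem exists_mem_component00_coordExt (hN : IsSaturatedModel L N κ) (hκ : ℵ₀ < κ) (hP : #P < κ)
    {g : D.GStar j} (hg : g ∈ component00 L κ P (D.coordGStar j)) :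
    ∃ a, ⟨a, g⟩ ∈ component00 L κ P (D.coordExt j) := by
  let I := {H : Subgroup (CocycleExt (D.hStar j)) |
    IsTypeDefinableOver L P (D.coordExt j '' H) ∧ #(CocycleExt (D.hStar j) ⧸ H) < κ}
  -- The fibre over `g`. The swap is there because `coordExt` lists the `A*`-coordinates first,
  -- while `fiber` fixes the left block.
  let F : I → Set (Fin D.m → N) := fun H => {v | Sum.elim g.1 v ∘ Sum.swap ∈ D.coordExt j '' H.1}
  have hF : ∀ {H : I} {a : D.AStar j}, a.1 ∈ F H ↔ ⟨a, g⟩ ∈ H.1 := by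
    intro H a
    have he : Sum.elim g.1 a.1 ∘ Sum.swap = D.coordExt j ⟨a, g⟩ := by
      funext i
      rcases i with i | i <;> rfl
    change Sum.elim g.1 a.1 ∘ Sum.swap ∈ D.coordExt j '' (H.1 : Set _) ↔ _
    rw [he, (D.coordExt_injective j).mem_set_image, SetLike.mem_coe]
  by_cases hI : Nonempty I
  · have hdir : Directed (· ⊇ ·) F := by
      intro H₁ H₂
      refine ⟨⟨H₁.1 ⊓ H₂.1, ?_, ?_⟩, ?_, ?_⟩
      · rw [Subgroup.coe_inf, Set.image_inter (D.coordExt_injective j)]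
        exact H₁.2.1.inter H₂.2.1
      · exact (Subgroup.mk_quotient_inf_le _ _).trans_lt (mul_lt_of_lt hκ.le H₁.2.2 H₂.2.2)
      · exact fun v hv => Set.image_mono inf_le_left hv
      · exact fun v hv => Set.image_mono inf_le_right hv
    obtain ⟨v, hv⟩ := hN.nonempty_iInter_of_directed (mk_union_range_lt hκ hP g.1)
      (fun H : I => (H.2.1.preimage_comp Sum.swap).fiber g.1) (F := F) (by
        intro H
        -- Each single fibre is nonempty: the image of `H` in `G*` is type-definable of bounded
        -- index, so it contains `G*^{00}`.
        obtain ⟨⟨a, g'⟩, hx, rfl⟩ := Subgroup.mem_sInf.1 hg (H.1.map (CocycleExt.sndHom _))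
          ⟨D.isTypeDefinableOver_map_sndHom hN hκ hP H.2.1,
            (CocycleExt.mk_quotient_map_sndHom_le _).trans_lt H.2.2⟩
        exact ⟨a.1, hF.2 hx⟩) hdir
    rw [Set.mem_iInter] at hv
    obtain ⟨⟨a, g'⟩, -, hx⟩ := hv hI.some
    obtain rfl : a.1 = v := funext fun i => congrFun hx (Sum.inl i)
    exact ⟨a, Subgroup.mem_sInf.2 fun H hH => hF.1 (hv ⟨H, hH⟩)⟩
  -- With no competing subgroups the component is the whole extension, so any first coordinate
  -- works.
  · exact ⟨0, Subgroup.mem_sInf.2 fun H hH => (hI ⟨H, hH⟩).elim⟩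

theorem isInvariantOver_fstMem_sup_and_mk_quotient_lt (hfin : h.image.Finite)
    (hdcl : ∀ a ∈ h.image, ∀ i, D.coordA a i ∈ definableClosure L B) {C : AddSubgroup (D.AStar j)}
    (hC : C.InvariantUnder (D.GStar j)) (hCB : IsInvariantOver L (j '' B) (D.coordAStar j '' C))
    (hCκ : #(D.AStar j ⧸ C) < κ) :
    IsInvariantOver L (j '' B) (D.coordExt j '' CocycleExt.fstMem _
      (hC.sup (D.hStar j).imageSubgroup_invariant) le_sup_right) ∧
    #(CocycleExt (D.hStar j) ⧸ CocycleExt.fstMem _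
      (hC.sup (D.hStar j).imageSubgroup_invariant) le_sup_right) < κ :=
  ⟨D.isInvariantOver_fstMem (D.isInvariantOver_sup_imageSubgroup hfin hdcl hCB),
    (CocycleExt.mk_quotient_fstMem_le le_sup_left).trans_lt hCκ⟩

end DefinableCocycle

/-! ### The theorem. -/

theorem mainTheorem1
    -- the structure `M`, the group `G` acting on the abelian group `A`, and the 2-cocycle `h`
    {L : FirstOrder.Language.{u, v}} {M : Type w} [L.Structure M]
    {G : Type uG} {A : Type uA} [Group G] [AddCommGroup A] [DistribMulAction G A]
    {h : TwoCocycle G A} {B : Set M} (hB : B.Finite)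
    (D : DefinableCocycle L B h)
    (hfin : h.image.Finite)
    (hdcl : ∀ a ∈ h.image, ∀ i, D.coordA a i ∈ definableClosure L B)
    -- the monster model `N`
    {N : Type w'} [L.Structure N] (j : M ↪ₑ[L] N) (κ : Cardinal.{w'}) (hN : IsMonster L M N κ)
    -- the subgroup `A₁` of `A*`
    (A₁ : AddSubgroup (D.AStar j))
    (hA₁_index : #(D.AStar j ⧸ A₁) < κ)
    (hA₁_type : IsTypeDefinableOver L (j '' B) (D.coordAStar j '' A₁))
    (hA₁_inv : A₁.InvariantUnder (D.GStar j))
    -- (i)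
    (h_nonsplit :
      ¬ ∃ f : component00 L κ (j '' B) (D.coordGStar j) → (D.hStar j).Coeff A₁ hA₁_inv,
        IsInvariantFunOver L (j '' B)
          (fun g : component00 L κ (j '' B) (D.coordGStar j) => D.coordGStar j (g : D.GStar j))
          (D.coordAStar j) f ∧
          (((D.hStar j).induced A₁ hA₁_inv).restrict
            (component00 L κ (j '' B) (D.coordGStar j))).IsSplitVia f)
    -- (ii)
    (h_torsionFree : IsAddTorsionFree ((D.hStar j).Coeff A₁ hA₁_inv)) :
    component000 L κ (j '' B) (D.coordExt j) ≠ component00 L κ (j '' B) (D.coordExt j) ∧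
    (component000 L κ (j '' B) (D.coordGStar j) = ⊤ →
      (∀ (H : AddSubgroup (D.AStar j)) (hH_inv : H.InvariantUnder (D.GStar j)),
        H ≠ ⊤ →
        IsTypeDefinableOver L (j '' B) (D.coordAStar j '' H) →
        #(D.AStar j ⧸ H) < κ →
        ¬ ∃ f : D.GStar j → (D.hStar j).Coeff H hH_inv,
          IsInvariantFunOver L (j '' B) (D.coordGStar j) (D.coordAStar j) f ∧
            ((D.hStar j).induced H hH_inv).IsSplitVia f) →
      component00 L κ (j '' B) (D.coordExt j) = ⊤) := by
  have hsat := hN.isSaturated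
  have hκ := hN.aleph0_lt
  have hP : #(j '' B) < κ := (hB.image j).lt_aleph0.trans hκ
  constructor
  · intro heq
    obtain ⟨hE₁, hE₂⟩ :=
      D.isInvariantOver_fstMem_sup_and_mk_quotient_lt hfin hdcl hA₁_inv hA₁_type.isInvariantOver hA₁_index
    -- The only use of the assumed equality: `E` is a competitor for the 000-component, and the
    -- equality passes the containment on to the type-definable one.
    have hKE : component00 L κ (j '' B) (D.coordExt j) ≤ CocycleExt.fstMem _
        (hA₁_inv.sup (D.hStar j).imageSubgroup_invariant) le_sup_right :=
      heq ▸ sInf_le ⟨hE₁, hE₂⟩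
    have hK : IsTypeDefinableOver L (j '' B)
        (D.coordExt j '' component00 L κ (j '' B) (D.coordExt j)) :=
      isTypeDefinableOver_component00 (D.coordExt_injective j)
        D.isTypeDefinableOver_range_coordExt (one_lt_aleph0.trans hκ)
    obtain ⟨f, hf, hf₁, hf₂⟩ := D.exists_invariant_split_of_subgroup hfin hdcl hK.isInvariantOver
      hA₁_inv hA₁_type.isInvariantOver (D.isInvariantOver_component00_coordGStar (κ := κ))
      (fun g hg => by
        obtain ⟨a, ha⟩ := D.exists_mem_component00_coordExt hsat hκ hP hg
        exact ⟨a, hKE ha, ha⟩)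
      (D.le_of_le_sup_imageSubgroup hsat hκ hP hfin
        (D.isTypeDefinableOver_interKernel hsat hκ hP hK) hA₁_type h_torsionFree
        fun a ha => hKE ha)
    exact h_nonsplit ⟨fun g => f g, hf, fun g₁ g₂ => hf₂ g₁ g₁.2 g₂ g₂.2, hf₁⟩
  · intro hG hsplit
    refine sInf_eq_top.2 fun K hK => ?_
    -- Invariance alone suffices for full projection, because `G*` equals its 000-component. This
    -- matters for the intersection with `E` below.
    have hmap : ∀ {K' : Subgroup (CocycleExt (D.hStar j))},
        IsInvariantOver L (j '' B) (D.coordExt j '' K') →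
        #(CocycleExt (D.hStar j) ⧸ K') < κ → K'.map (CocycleExt.sndHom _) = ⊤ := by
      intro K' h₁ h₂
      rw [eq_top_iff, ← hG]
      exact sInf_le ⟨D.isInvariantOver_map_sndHom h₁,
        (CocycleExt.mk_quotient_map_sndHom_le K').trans_lt h₂⟩
    have hKinv := hK.1.isInvariantOver
    have hKmap := hmap hKinv hK.2
    have hH_inv := CocycleExt.interKernel_invariantUnder hKmap
    have hH_type := D.isTypeDefinableOver_interKernel hsat hκ hP hK.1
    have hH_index := (CocycleExt.mk_quotient_interKernel_le K).trans_lt hK.2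
    have hH : CocycleExt.interKernel K = ⊤ := by
      by_contra hne
      refine hsplit _ hH_inv hne hH_type hH_index ?_
      obtain ⟨hE₁, hE₂⟩ :=
        D.isInvariantOver_fstMem_sup_and_mk_quotient_lt hfin hdcl hH_inv hH_type.isInvariantOver hH_index
      -- Intersecting with `E` yields lifts whose first coordinate is in `H + A₀`. Here `C` is `K ∩
      -- A*` itself, so torsion-freeness plays no role.
      have hKE := hmap (K' := K ⊓ CocycleExt.fstMem _
        (hH_inv.sup (D.hStar j).imageSubgroup_invariant) le_sup_right) (by
          rw [DefinableCocycle.isInvariantOver_image_coordExt] at hKinv hE₁ ⊢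
          exact fun σ hσ x hx => ⟨hKinv σ hσ x hx.1, hE₁ σ hσ x hx.2⟩)
        ((Subgroup.mk_quotient_inf_le _ _).trans_lt (mul_lt_of_lt hκ.le hK.2 hE₂))
      obtain ⟨f, hf, hf₁, hf₂⟩ := D.exists_invariant_split_of_subgroup (X := ⊤) hfin hdcl hKinv
        hH_inv hH_type.isInvariantOver
        ((D.isInvariantOver_image_coordGStar j).2 fun _ _ _ _ => Subgroup.mem_top _)
        (fun g _ => by
          obtain ⟨⟨a, g'⟩, hx, rfl⟩ : g ∈ Subgroup.map (CocycleExt.sndHom _) _ :=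
            hKE ▸ Subgroup.mem_top g
          exact ⟨a, hx.2, hx.1⟩) le_rfl
      refine ⟨f, ?_, fun g₁ g₂ => hf₂ g₁ trivial g₂ trivial, hf₁⟩
      -- The invariance obtained concerns functions on the subgroup `⊤`; it is carried over to
      -- functions on `G*`.
      rintro σ hσ v ⟨x, a, hfa, hv⟩
      obtain ⟨y, b, hfb, hw⟩ := hf σ hσ v ⟨⟨x, trivial⟩, a, hfa, hv⟩
      exact ⟨y, b, hfb, hw⟩
    rw [eq_top_iff]
    rintro ⟨a, g⟩ -
    -- `K` contains some `(b, g)` and all of `A*`, hence `(a - b, 1)(b, g) = (a, g)`.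
    obtain ⟨⟨b, g'⟩, hx, rfl⟩ : g ∈ K.map (CocycleExt.sndHom _) := hKmap ▸ Subgroup.mem_top g
    have := K.mul_mem (CocycleExt.mem_interKernel.1
      (hH ▸ AddSubgroup.mem_top (a - b) : a - b ∈ CocycleExt.interKernel K)) hx
    rwa [CocycleExt.mk_one_mul, sub_add_cancel] at this
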